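/- Let $M$ be a smooth manifold of dimension $2n+1$ with an almost paracontact metric structure $(\phi,\xi,\eta,g)$: $\phi$ is a $(1,1)$-tensor field, $\xi$ a vector field, $\eta$ a $1$-form and $g$ a pseudo-Riemannian metric (necessarily of signature $(n+1,n)$), all smooth, such that $\eta(\xi)=1$, $\phi^2=\mathrm{Id}-\eta\otimes\xi$, the eigenspaces of $\phi|_{\ker\eta}$ for the eigenvalues $1$ and $-1$ both have dimension $n$, and $g(\phi X,\phi Y)=-g(X,Y)+\eta(X)\eta(Y)$. Put $\Phi(X,Y)=g(\phi X,Y)$ and suppose that the structure is almost $\alpha$-para-Kenmotsu, that is, $d\eta=0$ and $d\Phi=2\alpha\,\eta\wedge\Phi$ for a real constant $\alpha$. Let $\nabla$ be the Levi-Civita connection of $g$, let $R(X,Y)Z=\nabla_X\nabla_YZ-\nabla_Y\nabla_XZ-\nabla_{[X,Y]}Z$, let $Q$ be the Ricci operator, given by $g(QY,Z)=\mathrm{tr}(X\mapsto R(X,Y)Z)$, let $h=\frac12\mathcal L_\xi\phi$, and let $$\nabla^*\nabla V=-\sum_i\varepsilon_i\left(\nabla_{e_i}\nabla_{e_i}V-\nabla_{\nabla_{e_i}e_i}V\right)$$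 be the rough Laplacian, where $(e_i)$ is any local pseudo-orthonormal frame, $g(e_i,e_j)=\varepsilon_i\delta_{ij}$, $\varepsilon_i=\pm1$ (the result does not depend on the frame). Then $$\nabla^*\nabla\xi=\left(2n\alpha^2-\mathrm{tr}(h^2)\right)\xi-(Q\xi)|_{\ker\eta},$$ where $(Q\xi)|_{\ker\eta}=Q\xi-\eta(Q\xi)\xi$ is the component of $Q\xi$ in $\ker\eta$. Consequently $\xi$ is a harmonic vector field, i.e. $\nabla^*\nabla\xi=f\xi$ for some function $f$ on $M$, if and only if $\xi$ is an eigenvector field of the Ricci operator, i.e. $Q\xi=f'\xi$ for some function $f'$ on $M$. -/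

import Mathlib

open Bundle Module VectorField
open scoped Manifold ContDiff Topology

noncomputable section

set_option linter.unusedSectionVars false

namespace ParaGeometry

variable {E : Type*} [NormedAddCommGroup E] [NormedSpace ℝ E]
  {H : Type*} [TopologicalSpace H] (I : ModelWithCorners ℝ E H)
  (M : Type*) [TopologicalSpace M] [ChartedSpace H M] [IsManifold I ∞ M]

/-- A smooth pseudo-Riemannian metric (of arbitrary signature) on `M`. -/
structure PseudoRiemannianMetric where
  /-- The scalar product on each tangent space. -/
  val (x : M) : TangentSpace I x →L[ℝ] TangentSpace I x →L[ℝ] ℝ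
  symm (x : M) (v w : TangentSpace I x) : val x v w = val x w v
  nondegenerate (x : M) (v : TangentSpace I x) (hv : ∀ w, val x v w = 0) : v = 0
  contMDiff : ContMDiff I (I.prod 𝓘(ℝ, E →L[ℝ] E →L[ℝ] ℝ)) ∞
    (fun x ↦ TotalSpace.mk' (E →L[ℝ] E →L[ℝ] ℝ) x (val x))

variable {I M}

namespace PseudoRiemannianMetric

variable (g : PseudoRiemannianMetric I M)

/-- The function `x ↦ g(X, Y)(x)`. -/
def pair (X Y : Π x : M, TangentSpace I x) : M → ℝ := fun x ↦ g.val x (X x) (Y x)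

lemma mdiff_pair {X Y : Π x : M, TangentSpace I x} {x : M}
    (hX : MDiffAt (T% X) x) (hY : MDiffAt (T% Y) x) : MDiffAt (g.pair X Y) x := by
  have h := MDifferentiableAt.clm_bundle_apply₂ (F₁ := E) (F₂ := E) (F₃ := ℝ)
    (E₁ := (TangentSpace I : M → Type _)) (E₂ := (TangentSpace I : M → Type _))
    (E₃ := Bundle.Trivial M ℝ) (b := fun x : M ↦ x)
    (ψ := g.val) ((g.contMDiff x).mdifferentiableAt (by simp)) hX hY
  simp only [mdifferentiableAt_totalSpace] at h
  exact h.2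

lemma pair_comm (X Y : Π x : M, TangentSpace I x) : g.pair X Y = g.pair Y X := by
  ext x; exact g.symm x _ _

lemma pair_smul_left (f : M → ℝ) (X Y : Π x : M, TangentSpace I x) :
    g.pair (f • X) Y = f * g.pair X Y := by
  ext x; simp [pair]

lemma pair_add_left (X X' Y : Π x : M, TangentSpace I x) :
    g.pair (X + X') Y = g.pair X Y + g.pair X' Y := by
  ext x; simp [pair]

lemma pair_smul_right (f : M → ℝ) (X Y : Π x : M, TangentSpace I x) :
    g.pair X (f • Y) = f * g.pair X Y := by
  ext x; simp [pair]

lemma pair_add_right (X Y Y' : Π x : M, TangentSpace I x) :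
    g.pair X (Y + Y') = g.pair X Y + g.pair X Y' := by
  ext x; simp [pair]

variable [CompleteSpace E] [FiniteDimensional ℝ E]

/-- A covariant derivative on `TM` is a Levi-Civita connection of `g` if it is torsion-free and
`X g(Y, Z) = g(∇_X Y, Z) + g(Y, ∇_X Z)`. Recall that `∇_X Y` at `x` is `cov Y x (X x)`. -/
structure IsLeviCivita (cov : CovariantDerivative I E (TangentSpace I : M → Type _)) : Prop where
  torsion_eq_zero : cov.torsion = 0
  metric {x : M} {Y Z : Π x : M, TangentSpace I x}
    (hY : MDiffAt (T% Y) x) (hZ : MDiffAt (T% Z) x) (v : TangentSpace I x) :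
    mvfderiv I (g.pair Y Z) x v = g.val x (cov Y x v) (Z x) + g.val x (Y x) (cov Z x v)

/-- The right-hand side of the Koszul formula for `2 g(∇_X Y, Z)`. -/
def koszul (X Y Z : Π x : M, TangentSpace I x) (x : M) : ℝ :=
  mvfderiv I (g.pair Y Z) x (X x) + mvfderiv I (g.pair X Z) x (Y x)
    - mvfderiv I (g.pair X Y) x (Z x)
    + g.val x (mlieBracket I X Y x) (Z x) - g.val x (mlieBracket I X Z x) (Y x)
    - g.val x (mlieBracket I Y Z x) (X x)

lemma koszul_smul_left {f : M → ℝ} {X Y Z : Π x : M, TangentSpace I x} {x : M}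
    (hf : MDiffAt f x) (hX : MDiffAt (T% X) x) (hY : MDiffAt (T% Y) x) (hZ : MDiffAt (T% Z) x) :
    g.koszul (f • X) Y Z x = f x * g.koszul X Y Z x := by
  simp only [koszul, pair_smul_left, mvfderiv_mul hf (g.mdiff_pair hX hZ),
    mvfderiv_mul hf (g.mdiff_pair hX hY), mlieBracket_smul_left hf hX]
  simp [pair]
  ring

lemma koszul_smul_right {f : M → ℝ} {X Y Z : Π x : M, TangentSpace I x} {x : M}
    (hf : MDiffAt f x) (hX : MDiffAt (T% X) x) (hY : MDiffAt (T% Y) x) (hZ : MDiffAt (T% Z) x) :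
    g.koszul X Y (f • Z) x = f x * g.koszul X Y Z x := by
  simp only [koszul, pair_smul_right, mvfderiv_mul hf (g.mdiff_pair hX hZ),
    mvfderiv_mul hf (g.mdiff_pair hY hZ), mlieBracket_smul_right hf hZ]
  simp [pair, g.symm x (Z x) (X x), g.symm x (Z x) (Y x)]
  ring

lemma koszul_smul_mid {f : M → ℝ} {X Y Z : Π x : M, TangentSpace I x} {x : M}
    (hf : MDiffAt f x) (hX : MDiffAt (T% X) x) (hY : MDiffAt (T% Y) x) (hZ : MDiffAt (T% Z) x) :
    g.koszul X (f • Y) Z x =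
      f x * g.koszul X Y Z x + 2 * (mvfderiv I f x (X x) * g.val x (Y x) (Z x)) := by
  simp only [koszul, pair_smul_right, pair_smul_left, mvfderiv_mul hf (g.mdiff_pair hX hY),
    mvfderiv_mul hf (g.mdiff_pair hY hZ), mlieBracket_smul_right hf hY,
    mlieBracket_smul_left hf hY]
  simp [pair, g.symm x (Y x) (X x)]
  ring

lemma koszul_add_left {X X' Y Z : Π x : M, TangentSpace I x} {x : M}
    (hX : MDiffAt (T% X) x) (hX' : MDiffAt (T% X') x)
    (hY : MDiffAt (T% Y) x) (hZ : MDiffAt (T% Z) x) :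
    g.koszul (X + X') Y Z x = g.koszul X Y Z x + g.koszul X' Y Z x := by
  simp only [koszul, pair_add_left, mvfderiv_add (g.mdiff_pair hX hZ) (g.mdiff_pair hX' hZ),
    mvfderiv_add (g.mdiff_pair hX hY) (g.mdiff_pair hX' hY), mlieBracket_add_left hX hX']
  simp
  ring

lemma koszul_add_mid {X Y Y' Z : Π x : M, TangentSpace I x} {x : M}
    (hX : MDiffAt (T% X) x) (hY : MDiffAt (T% Y) x)
    (hY' : MDiffAt (T% Y') x) (hZ : MDiffAt (T% Z) x) :
    g.koszul X (Y + Y') Z x = g.koszul X Y Z x + g.koszul X Y' Z x := by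
  simp only [koszul, pair_add_left, pair_add_right,
    mvfderiv_add (g.mdiff_pair hY hZ) (g.mdiff_pair hY' hZ),
    mvfderiv_add (g.mdiff_pair hX hY) (g.mdiff_pair hX hY'), mlieBracket_add_left hY hY',
    mlieBracket_add_right hY hY']
  simp
  ring

lemma koszul_add_right {X Y Z Z' : Π x : M, TangentSpace I x} {x : M}
    (hX : MDiffAt (T% X) x) (hY : MDiffAt (T% Y) x)
    (hZ : MDiffAt (T% Z) x) (hZ' : MDiffAt (T% Z') x) :
    g.koszul X Y (Z + Z') x = g.koszul X Y Z x + g.koszul X Y Z' x := by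
  simp only [koszul, pair_add_right,
    mvfderiv_add (g.mdiff_pair hY hZ) (g.mdiff_pair hY hZ'),
    mvfderiv_add (g.mdiff_pair hX hZ) (g.mdiff_pair hX hZ'), mlieBracket_add_right hZ hZ']
  simp
  ring

/-- The Koszul formula determines `∇ Y` at a point where `Y` is differentiable. -/
lemma exists_koszul {Y : Π x : M, TangentSpace I x} {x : M} (hY : MDiffAt (T% Y) x) :
    ∃ A : TangentSpace I x →L[ℝ] TangentSpace I x, ∀ X Z : Π x : M, TangentSpace I x,
      MDiffAt (T% X) x → MDiffAt (T% Z) x → 2 * g.val x (A (X x)) (Z x) = g.koszul X Y Z x := by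
  have h₁ : ∀ Z, MDiffAt (T% Z) x → TensorialAt I E (fun X ↦ g.koszul X Y Z x) x := fun Z hZ ↦
    ⟨fun hf hX ↦ g.koszul_smul_left hf hX hY hZ, fun hX hX' ↦ g.koszul_add_left hX hX' hY hZ⟩
  have h₂ : ∀ X, MDiffAt (T% X) x → TensorialAt I E (fun Z ↦ g.koszul X Y Z x) x := fun X hX ↦
    ⟨fun hf hZ ↦ g.koszul_smul_right hf hX hY hZ, fun hZ hZ' ↦ g.koszul_add_right hX hY hZ hZ'⟩
  have : FiniteDimensional ℝ (TangentSpace I x) := inferInstanceAs (FiniteDimensional ℝ E)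
  let B := TensorialAt.mkHom₂ (fun X Z ↦ g.koszul X Y Z x) x h₁ h₂
  let G : TangentSpace I x →ₗ[ℝ] Module.Dual ℝ (TangentSpace I x) :=
    { toFun := fun v ↦ (g.val x v).toLinearMap
      map_add' := fun v w ↦ by ext; simp
      map_smul' := fun c v ↦ by ext; simp }
  have hG : Function.Injective G := by
    rw [← LinearMap.ker_eq_bot, LinearMap.ker_eq_bot']
    exact fun v hv ↦ g.nondegenerate x v fun w ↦ LinearMap.congr_fun hv w
  let G' := LinearEquiv.ofInjectiveOfFinrankEq G hG Subspace.dual_finrank_eq.symm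
  let B' : TangentSpace I x →ₗ[ℝ] Module.Dual ℝ (TangentSpace I x) :=
    { toFun := fun v ↦ (B v).toLinearMap
      map_add' := fun v w ↦ by ext; simp
      map_smul' := fun c v ↦ by ext; simp }
  let A : TangentSpace I x →ₗ[ℝ] TangentSpace I x := (2 : ℝ)⁻¹ • (G'.symm.toLinearMap ∘ₗ B')
  have : T2Space (TangentSpace I x) := inferInstanceAs (T2Space E)
  refine ⟨LinearMap.toContinuousLinearMap A, fun X Z hX hZ ↦ ?_⟩
  have h3 : G (G'.symm (B (X x)).toLinearMap) = (B (X x)).toLinearMap :=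
    G'.apply_symm_apply _
  have h4 : g.val x (G'.symm (B (X x)).toLinearMap) (Z x) = B (X x) (Z x) :=
    LinearMap.congr_fun h3 (Z x)
  have h5 : B (X x) (Z x) = g.koszul X Y Z x := TensorialAt.mkHom₂_apply h₁ h₂ hX hZ
  have h6 : A (X x) = (2 : ℝ)⁻¹ • G'.symm (B (X x)).toLinearMap := rfl
  rw [LinearMap.coe_toContinuousLinearMap', h6]
  simp [h4, h5]

lemma eq_of_val_eq {x : M} {v w : TangentSpace I x} (h : ∀ u, g.val x v u = g.val x w u) :
    v = w := by
  rw [← sub_eq_zero]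
  exact g.nondegenerate x _ fun u ↦ by simp [h u]

/-- Fundamental theorem of pseudo-Riemannian geometry: existence. -/
theorem exists_isLeviCivita :
    ∃ cov : CovariantDerivative I E (TangentSpace I : M → Type _), g.IsLeviCivita cov := by
  classical
  let D : (Π x : M, TangentSpace I x) → (Π x : M, TangentSpace I x →L[ℝ] TangentSpace I x) :=
    fun Y x ↦ if hY : MDiffAt (T% Y) x then (g.exists_koszul hY).choose else 0
  have hD {Y : Π x : M, TangentSpace I x} {x : M} (hY : MDiffAt (T% Y) x)
      (X Z : Π x : M, TangentSpace I x) (hX : MDiffAt (T% X) x) (hZ : MDiffAt (T% Z) x) :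
      2 * g.val x (D Y x (X x)) (Z x) = g.koszul X Y Z x := by
    have : D Y x = (g.exists_koszul hY).choose := dif_pos hY
    rw [this]
    exact (g.exists_koszul hY).choose_spec X Z hX hZ
  have hext {x : M} (v : TangentSpace I x) : MDiffAt (T% (FiberBundle.extend E v)) x :=
    FiberBundle.mdifferentiableAt_extend I E v
  have hD' {Y : Π x : M, TangentSpace I x} {x : M} (hY : MDiffAt (T% Y) x)
      (v w : TangentSpace I x) : 2 * g.val x (D Y x v) w =
        g.koszul (FiberBundle.extend E v) Y (FiberBundle.extend E w) x := by
    have := hD hY _ _ (hext v) (hext w)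
    simpa using this
  have hcov : IsCovariantDerivativeOn E D Set.univ :=
    { add := by
        intro Y Y' x hY hY' _
        ext v
        refine g.eq_of_val_eq fun w ↦ ?_
        have h1 := hD' (Y := Y + Y') (mdifferentiableAt_add_section hY hY') v w
        rw [g.koszul_add_mid (hext v) hY hY' (hext w), ← hD' hY, ← hD' hY'] at h1
        simp only [_root_.add_apply, map_add]
        linarith
      leibniz := by
        intro Y f x hY hf _
        ext v
        refine g.eq_of_val_eq fun w ↦ ?_
        have h1 := hD' (Y := f • Y) (hf.smul_section hY) v w
        rw [g.koszul_smul_mid hf (hext v) hY (hext w), ← hD' hY] at h1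
        simp at h1 ⊢
        linarith }
  refine ⟨⟨D, hcov⟩, ?_, ?_⟩
  · rw [CovariantDerivative.torsion_eq_zero_iff]
    intro X Y x hX hY
    refine g.eq_of_val_eq fun w ↦ ?_
    have h1 := hD hY X _ hX (hext w)
    have h2 := hD hX Y _ hY (hext w)
    simp only [koszul, FiberBundle.extend_apply_self, g.pair_comm Y X,
      mlieBracket_swap_apply (V := Y) (W := X)] at h1 h2
    simp at h1 h2 ⊢
    linarith
  · intro x Y Z hY hZ v
    have h1 := hD hY _ Z (hext v) hZ
    have h2 := hD hZ _ Y (hext v) hY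
    rw [g.symm x (Y x)]
    simp only [koszul, FiberBundle.extend_apply_self, g.pair_comm Z Y,
      mlieBracket_swap_apply (V := Z) (W := Y)] at h1 h2
    simp at h1 h2 ⊢
    linarith

/-- The Levi-Civita connection of `g`. -/
def leviCivita : CovariantDerivative I E (TangentSpace I : M → Type _) :=
  g.exists_isLeviCivita.choose

theorem isLeviCivita_leviCivita : g.IsLeviCivita g.leviCivita :=
  g.exists_isLeviCivita.choose_spec

/-- The vector field `∇_X Y`. -/
def nabla (X Y : Π x : M, TangentSpace I x) : Π x : M, TangentSpace I x :=
  fun x ↦ g.leviCivita Y x (X x)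

/-- The curvature `R(X, Y)Z = ∇_X ∇_Y Z - ∇_Y ∇_X Z - ∇_{[X, Y]} Z`. -/
def curvature (X Y Z : Π x : M, TangentSpace I x) : Π x : M, TangentSpace I x :=
  g.nabla X (g.nabla Y Z) - g.nabla Y (g.nabla X Z) - g.nabla (mlieBracket I X Y) Z

/-- `e` is a pseudo-orthonormal family at `x` with signs `ε`. -/
structure IsPseudoOrthonormal {ι : Type*} (x : M) (e : ι → TangentSpace I x) (ε : ι → ℝ) :
    Prop where
  sign (i : ι) : ε i = 1 ∨ ε i = -1
  self (i : ι) : g.val x (e i) (e i) = ε i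
  ortho (i j : ι) (hij : i ≠ j) : g.val x (e i) (e j) = 0

lemma exists_isPseudoOrthonormal (x : M) :
    ∃ (e : Fin (finrank ℝ E) → TangentSpace I x) (ε : Fin (finrank ℝ E) → ℝ),
      g.IsPseudoOrthonormal x e ε := by
  have : FiniteDimensional ℝ (TangentSpace I x) := inferInstanceAs (FiniteDimensional ℝ E)
  let B : LinearMap.BilinForm ℝ (TangentSpace I x) :=
    LinearMap.mk₂ ℝ (fun v w ↦ g.val x v w) (by simp) (by simp) (by simp) (by simp)
  have hB : LinearMap.IsSymm B := ⟨fun v w ↦ g.symm x v w⟩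
  obtain ⟨v, hv⟩ := LinearMap.BilinForm.exists_orthogonal_basis hB
  have hne (i) : g.val x (v i) (v i) ≠ 0 := by
    intro h0
    refine v.ne_zero i (g.nondegenerate x _ fun w ↦ ?_)
    rw [← v.sum_repr w]
    simp only [map_sum, map_smul]
    refine Finset.sum_eq_zero fun j _ ↦ ?_
    by_cases hij : i = j
    · subst hij; simp [h0]
    · have : g.val x (v i) (v j) = 0 := hv hij
      simp [this]
  refine ⟨fun i ↦ (Real.sqrt |g.val x (v i) (v i)|)⁻¹ • v i,
    fun i ↦ SignType.sign (g.val x (v i) (v i)), ⟨fun i ↦ ?_, fun i ↦ ?_, fun i j hij ↦ ?_⟩⟩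
  · rcases lt_or_gt_of_ne (hne i) with h | h
    · simp [sign_neg h]
    · simp [sign_pos h]
  · have hpos : 0 < |g.val x (v i) (v i)| := abs_pos.mpr (hne i)
    have hs := Real.mul_self_sqrt hpos.le
    have hs0 := (Real.sqrt_pos.mpr hpos).ne'
    have h3 := sign_mul_abs (g.val x (v i) (v i))
    simp only [map_smul, _root_.smul_apply, smul_eq_mul]
    field_simp
    rw [sq, hs, mul_comm]
    exact h3.symm
  · have : g.val x (v i) (v j) = 0 := hv hij
    simp [this]

/-- A pseudo-orthonormal basis of the tangent space at `x`. -/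
def basisAt (x : M) : Fin (finrank ℝ E) → TangentSpace I x :=
  (g.exists_isPseudoOrthonormal x).choose

/-- The signs `ε_i = g(e_i, e_i)` of the basis `basisAt`. -/
def signAt (x : M) : Fin (finrank ℝ E) → ℝ :=
  (g.exists_isPseudoOrthonormal x).choose_spec.choose

lemma isPseudoOrthonormal_basisAt (x : M) :
    g.IsPseudoOrthonormal x (g.basisAt x) (g.signAt x) :=
  (g.exists_isPseudoOrthonormal x).choose_spec.choose_spec

/-- The Ricci tensor `S(v, w) = tr (u ↦ R(u, v)w) = ∑ ε_i g(R(e_i, v)w, e_i)`. The curvature is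
a tensor, so the tangent vectors may be extended to vector fields in any smooth way. -/
def ricci (x : M) (v w : TangentSpace I x) : ℝ :=
  ∑ i, g.signAt x i * g.val x (g.curvature (FiberBundle.extend E (g.basisAt x i))
    (FiberBundle.extend E v) (FiberBundle.extend E w) x) (g.basisAt x i)

/-- The Ricci operator `Q`, given by `g(Q v, w) = S(v, w)`. -/
def ricciOperator (x : M) (v : TangentSpace I x) : TangentSpace I x :=
  ∑ i, (g.signAt x i * g.ricci x v (g.basisAt x i)) • g.basisAt x i

/-- The expression `-∑ ε_i (∇_{e_i} ∇_{e_i} V - ∇_{∇_{e_i} e_i} V)` at `x`. -/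
def roughLaplacianAlong {ι : Type*} [Fintype ι] (e : ι → Π x : M, TangentSpace I x) (ε : ι → ℝ)
    (V : Π x : M, TangentSpace I x) (x : M) : TangentSpace I x :=
  -∑ i, ε i • (g.nabla (e i) (g.nabla (e i) V) x - g.nabla (g.nabla (e i) (e i)) V x)

/-- The rough Laplacian `∇*∇V = -tr_g ∇²V`. -/
def roughLaplacian (V : Π x : M, TangentSpace I x) (x : M) : TangentSpace I x :=
  g.roughLaplacianAlong (fun i ↦ FiberBundle.extend E (g.basisAt x i)) (g.signAt x) V x

/-- `e` is a smooth local pseudo-orthonormal frame near `x`, with signs `ε`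
(when `ι` has `dim M` elements). -/
structure IsLocalPseudoOrthonormalFrame {ι : Type*} (x : M) (e : ι → Π x : M, TangentSpace I x)
    (ε : ι → ℝ) : Prop where
  contMDiffAt (i : ι) : CMDiffAt ∞ (T% (e i)) x
  isPseudoOrthonormal : ∀ᶠ y in 𝓝 x, g.IsPseudoOrthonormal y (fun i ↦ e i y) ε

/-- `V` is a harmonic vector field: `∇*∇V` is collinear to `V`. -/
def IsHarmonicVectorField (V : Π x : M, TangentSpace I x) : Prop :=
  ∃ f : M → ℝ, ∀ x, g.roughLaplacian V x = f x • V x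

/-- `V` is an eigenvector field of the Ricci operator. -/
def IsRicciEigenvector (V : Π x : M, TangentSpace I x) : Prop :=
  ∃ f : M → ℝ, ∀ x, g.ricciOperator x (V x) = f x • V x

end PseudoRiemannianMetric

/-- The exterior derivative of a 1-form:
`X η(Y) - Y η(X) - η([X, Y])`. -/
def extDerivOne (η : Π x : M, TangentSpace I x →L[ℝ] ℝ) (X Y : Π x : M, TangentSpace I x)
    (x : M) : ℝ :=
  mvfderiv I (fun y ↦ η y (Y y)) x (X x) - mvfderiv I (fun y ↦ η y (X y)) x (Y x)
    - η x (mlieBracket I X Y x)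

/-- The exterior derivative of a 2-form:
`X Φ(Y, Z) + Y Φ(Z, X) + Z Φ(X, Y) - Φ([X, Y], Z) - Φ([Y, Z], X) - Φ([Z, X], Y)`. -/
def extDerivTwo (Φ : Π x : M, TangentSpace I x → TangentSpace I x → ℝ)
    (X Y Z : Π x : M, TangentSpace I x) (x : M) : ℝ :=
  mvfderiv I (fun y ↦ Φ y (Y y) (Z y)) x (X x) + mvfderiv I (fun y ↦ Φ y (Z y) (X y)) x (Y x)
    + mvfderiv I (fun y ↦ Φ y (X y) (Y y)) x (Z x)
    - Φ x (mlieBracket I X Y x) (Z x) - Φ x (mlieBracket I Y Z x) (X x)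
    - Φ x (mlieBracket I Z X x) (Y x)

/-- The wedge product `η ∧ Φ` of a 1-form and a 2-form. -/
def wedge {x : M} (η : TangentSpace I x →L[ℝ] ℝ) (Φ : TangentSpace I x → TangentSpace I x → ℝ)
    (u v w : TangentSpace I x) : ℝ :=
  η u * Φ v w + η v * Φ w u + η w * Φ u v

variable (I M) in
/-- An almost paracontact metric structure `(φ, ξ, η, g)` on a manifold `M` of dimension `2n + 1`.
Nondegeneracy and `compat` force the signature of `g` to be `(n + 1, n)`. -/
structure AlmostParacontactMetric (n : ℕ) where
  /-- The affinor `φ`. -/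
  φ (x : M) : TangentSpace I x →L[ℝ] TangentSpace I x
  /-- The characteristic vector field. -/
  ξ (x : M) : TangentSpace I x
  /-- The 1-form `η`. -/
  η (x : M) : TangentSpace I x →L[ℝ] ℝ
  /-- The pseudo-Riemannian metric. -/
  g : PseudoRiemannianMetric I M
  contMDiff_φ : ContMDiff I (I.prod 𝓘(ℝ, E →L[ℝ] E)) ∞
    (fun x ↦ (TotalSpace.mk' (E →L[ℝ] E) x (φ x) :
      TotalSpace (E →L[ℝ] E) fun x : M ↦ TangentSpace I x →L[ℝ] TangentSpace I x))
  contMDiff_ξ : CMDiff ∞ (T% ξ)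
  contMDiff_η : ContMDiff I (I.prod 𝓘(ℝ, E →L[ℝ] ℝ)) ∞
    (fun x ↦ (TotalSpace.mk' (E →L[ℝ] ℝ) x (η x) :
      TotalSpace (E →L[ℝ] ℝ) fun x : M ↦ TangentSpace I x →L[ℝ] Bundle.Trivial M ℝ x))
  η_ξ (x : M) : η x (ξ x) = 1
  φ_sq (x : M) (v : TangentSpace I x) : φ x (φ x v) = v - η x v • ξ x
  finrank_pos (x : M) : finrank ℝ ↥(LinearMap.ker (η x).toLinearMap ⊓
    Module.End.eigenspace (φ x).toLinearMap 1) = n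
  finrank_neg (x : M) : finrank ℝ ↥(LinearMap.ker (η x).toLinearMap ⊓
    Module.End.eigenspace (φ x).toLinearMap (-1)) = n
  compat (x : M) (v w : TangentSpace I x) :
    g.val x (φ x v) (φ x w) = -g.val x v w + η x v * η x w

namespace AlmostParacontactMetric

variable {n : ℕ} (S : AlmostParacontactMetric I M n)

/-- The fundamental form `Φ(X, Y) = g(φX, Y)`. -/
def fundamentalForm (x : M) (v w : TangentSpace I x) : ℝ := S.g.val x (S.φ x v) w

/-- Almost `α`-para-Kenmotsu: `dη = 0` and `dΦ = 2α η ∧ Φ`, with `α` a constant. -/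
structure IsAlmostParaKenmotsu (α : ℝ) : Prop where
  closed (x : M) (X Y : Π x : M, TangentSpace I x) (hX : MDiffAt (T% X) x)
    (hY : MDiffAt (T% Y) x) : extDerivOne S.η X Y x = 0
  dΦ (x : M) (X Y Z : Π x : M, TangentSpace I x) (hX : MDiffAt (T% X) x)
    (hY : MDiffAt (T% Y) x) (hZ : MDiffAt (T% Z) x) :
    extDerivTwo S.fundamentalForm X Y Z x =
      2 * α * wedge (S.η x) (S.fundamentalForm x) (X x) (Y x) (Z x)

/-- The vector field `φX`. -/
def φField (X : Π x : M, TangentSpace I x) : Π x : M, TangentSpace I x := fun x ↦ S.φ x (X x)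

lemma mdiff_φField {X : Π x : M, TangentSpace I x} {x : M} (hX : MDiffAt (T% X) x) :
    MDiffAt (T% (S.φField X)) x :=
  MDifferentiableAt.clm_bundle_apply (F₁ := E) (F₂ := E)
    (E₁ := (TangentSpace I : M → Type _)) (E₂ := (TangentSpace I : M → Type _))
    (b := fun x : M ↦ x) (ϕ := S.φ) ((S.contMDiff_φ x).mdifferentiableAt (by simp)) hX

/-- The Lie derivative `(L_ξ φ)X = [ξ, φX] - φ[ξ, X]`. -/
def lieDerivφ (X : Π x : M, TangentSpace I x) (x : M) : TangentSpace I x :=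
  mlieBracket I S.ξ (S.φField X) x - S.φ x (mlieBracket I S.ξ X x)

variable [CompleteSpace E] [FiniteDimensional ℝ E]

lemma tensorial_lieDerivφ (x : M) : TensorialAt I E (S.lieDerivφ · x) x where
  smul {f X} hf hX := by
    have : S.φField (f • X) = f • S.φField X := by ext y; simp [φField]
    simp only [lieDerivφ, this, mlieBracket_smul_right hf hX,
      mlieBracket_smul_right hf (S.mdiff_φField hX)]
    simp [φField, smul_sub]
  add {X X'} hX hX' := by
    have : S.φField (X + X') = S.φField X + S.φField X' := by ext y; simp [φField]
    simp only [lieDerivφ, this, mlieBracket_add_right hX hX',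
      mlieBracket_add_right (S.mdiff_φField hX) (S.mdiff_φField hX')]
    simp only [map_add]
    abel

/-- The tensor field `h = ½ L_ξ φ`. -/
def h (x : M) : TangentSpace I x →L[ℝ] TangentSpace I x :=
  (1 / 2 : ℝ) • TensorialAt.mkHom (S.lieDerivφ · x) x (S.tensorial_lieDerivφ x)

/-- The trace of `h²`. -/
def traceHSq (x : M) : ℝ :=
  LinearMap.trace ℝ (TangentSpace I x) ((S.h x).toLinearMap ∘ₗ (S.h x).toLinearMap)

/-- The component of a tangent vector in `ker η`, along `TM = ker η ⊕ ℝξ`. -/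
def horizontal (x : M) (v : TangentSpace I x) : TangentSpace I x := v - S.η x v • S.ξ x

end AlmostParacontactMetric

end ParaGeometry

end

/-! Write `A = ∇ξ`. Everything follows from three facts about `A`: it is `g`-symmetric, it kills
`ξ`, and it has constant trace `2nα`.

For any field `V` with `∇V` symmetric, the form `g(∇²_{v,w}V, u)` is symmetric in `w, u`, so
`g(∇*∇V, u)` is minus the trace of `v ↦ ∇²_{v,u}V`. Exchanging the derivatives and tracing gives
`Ric(V, u) = tr(v ↦ ∇²_{v,u}V) - u(tr ∇V)`. If `tr ∇V` is constant, then `∇*∇V = -QV`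
(`roughLaplacian_eq_neg_ricciOperator`). This already yields the equivalence; the formula needs only
the `ξ`-component of `Qξ`.

Closedness of `η` makes `A` symmetric (`val_shape`). The equation for `dΦ` gives `h = αφ - Aφ`
(`h_eq`), and `L_ξ(φ²) = 0` gives `hφ = -φh` (`h_φ`). Hence `tr(hφ) = 0`, so `tr A = 2nα`, and
expanding `h²` gives `tr A² = 2nα² - tr h²` (`trace_shape`). Finally `∇²_{v,ξ}ξ = -A²v` because `Aξ
= 0`, so `-η(Qξ) = tr A²` (`η_ricciOperator`). -/

noncomputable section

set_option linter.unusedSectionVars false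

namespace ParaGeometry

/-! ### Differentiability of `∇_X Y` -/

section Regularity

variable {E : Type*} [NormedAddCommGroup E] [NormedSpace ℝ E]
  {H : Type*} [TopologicalSpace H] {I : ModelWithCorners ℝ E H}
  {M : Type*} [TopologicalSpace M] [ChartedSpace H M] [IsManifold I ∞ M]

lemma mdifferentiableAt_sum {F : Type*} [NormedAddCommGroup F] [NormedSpace ℝ F] {ι : Type*}
    (s : Finset ι) {f : ι → M → F} {x : M} (hf : ∀ i, MDiffAt (f i) x) :
    MDiffAt (fun y ↦ ∑ i ∈ s, f i y) x := by
  classical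
  induction s using Finset.induction_on with
  | empty => simpa using mdifferentiableAt_const
  | insert a s ha h => simp only [Finset.sum_insert ha]; exact (hf a).add h

lemma mvfderiv_sum {F : Type*} [NormedAddCommGroup F] [NormedSpace ℝ F] {ι : Type*}
    (s : Finset ι) {f : ι → M → F} {x : M} (hf : ∀ i, MDiffAt (f i) x) :
    mvfderiv I (fun y ↦ ∑ i ∈ s, f i y) x = ∑ i ∈ s, mvfderiv I (f i) x := by
  classical
  induction s using Finset.induction_on with
  | empty => simp only [Finset.sum_empty]; exact mvfderiv_zero
  | insert a s ha h =>
    simp only [Finset.sum_insert ha, ← h]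
    exact mvfderiv_add (hf a) (mdifferentiableAt_sum s hf)

lemma mdifferentiableAt_mvfderiv_apply {f : M → ℝ} {X : Π x : M, TangentSpace I x} {x : M}
    (hf : CMDiffAt 2 f x) (hX : MDiffAt (T% X) x) :
    MDiffAt (fun y ↦ mvfderiv I f y (X y)) x := by
  have h1 : CMDiffAt 1 (inTangentCoordinates I 𝓘(ℝ, ℝ) id f (mfderiv I 𝓘(ℝ, ℝ) f) x) x :=
    hf.mfderiv_const (by norm_num)
  have h2 := MDifferentiableAt.clm_apply_of_inCoordinates (b₁ := id) (b₂ := f)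
    (E₁ := (TangentSpace I : M → Type _)) (E₂ := (TangentSpace 𝓘(ℝ, ℝ) : ℝ → Type _))
    (ϕ := mfderiv I 𝓘(ℝ, ℝ) f) (v := X) (h1.mdifferentiableAt one_ne_zero) hX
    (hf.mdifferentiableAt two_ne_zero)
  rw [mdifferentiableAt_totalSpace] at h2
  have h3 : MDifferentiableAt I 𝓘(ℝ, ℝ) (fun y ↦ mfderiv I 𝓘(ℝ, ℝ) f y (X y)) x := by
    simpa using h2.2
  exact h3

lemma eventually_mdifferentiableAt {X : Π x : M, TangentSpace I x} {x : M}
    (hX : CMDiffAt 2 (T% X) x) : ∀ᶠ y in 𝓝 x, MDiffAt (T% X) y :=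
  ((contMDiffAt_iff_contMDiffAt_nhds (by simp)).1 hX).mono
    fun _ hy ↦ hy.mdifferentiableAt two_ne_zero

lemma mdifferentiableAt_mlieBracket [CompleteSpace E] {X Y : Π x : M, TangentSpace I x} {x : M}
    (hX : CMDiffAt 2 (T% X) x) (hY : CMDiffAt 2 (T% Y) x) :
    MDiffAt (T% (mlieBracket I X Y)) x := by
  have : IsManifold I (minSmoothness ℝ 2) M := by
    rw [minSmoothness_of_isRCLikeNormedField]; infer_instance
  have : IsManifold I (((2 : ℕ∞) : ℕ∞ω) + 1) M := IsManifold.of_le (n := ∞) (mod_cast le_top)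
  exact (hX.mlieBracket_vectorField (m := 1) (n := 2) hY (by norm_num)).mdifferentiableAt
    one_ne_zero

namespace PseudoRiemannianMetric

variable (g : PseudoRiemannianMetric I M)

lemma contMDiffAt_pair {k : ℕ∞} {X Y : Π x : M, TangentSpace I x} {x : M}
    (hX : CMDiffAt k (T% X) x) (hY : CMDiffAt k (T% Y) x) : CMDiffAt k (g.pair X Y) x := by
  have h := ContMDiffAt.clm_bundle_apply₂ (F₁ := E) (F₂ := E) (F₃ := ℝ)
    (E₁ := (TangentSpace I : M → Type _)) (E₂ := (TangentSpace I : M → Type _))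
    (E₃ := Bundle.Trivial M ℝ) (b := fun x : M ↦ x)
    (ψ := g.val) ((g.contMDiff x).of_le (mod_cast le_top)) hX hY
  simp only [contMDiffAt_totalSpace] at h
  exact h.2

variable [CompleteSpace E] [FiniteDimensional ℝ E]

lemma mdifferentiableAt_koszul {X Y Z : Π x : M, TangentSpace I x} {x : M}
    (hX : CMDiffAt 2 (T% X) x) (hY : CMDiffAt 2 (T% Y) x) (hZ : CMDiffAt 2 (T% Z) x) :
    MDiffAt (g.koszul X Y Z) x := by
  have d {X : Π x : M, TangentSpace I x} (hX : CMDiffAt 2 (T% X) x) : MDiffAt (T% X) x :=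
    hX.mdifferentiableAt two_ne_zero
  have p {X Y Z : Π x : M, TangentSpace I x} (hX : CMDiffAt 2 (T% X) x)
      (hY : CMDiffAt 2 (T% Y) x) (hZ : CMDiffAt 2 (T% Z) x) :
      MDiffAt (fun y ↦ mvfderiv I (g.pair Y Z) y (X y)) x :=
    mdifferentiableAt_mvfderiv_apply (g.contMDiffAt_pair (k := 2) hY hZ) (d hX)
  exact (((((p hX hY hZ).add (p hY hX hZ)).sub (p hZ hX hY)).add
    (g.mdiff_pair (mdifferentiableAt_mlieBracket hX hY) (d hZ))).sub
    (g.mdiff_pair (mdifferentiableAt_mlieBracket hX hZ) (d hY))).sub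
    (g.mdiff_pair (mdifferentiableAt_mlieBracket hY hZ) (d hX))

/-- A vector field is differentiable if its scalar products with sufficiently many smooth fields
are. -/
lemma mdifferentiableAt_of_pair {V : Π x : M, TangentSpace I x} {x : M}
    (hV : ∀ v : TangentSpace I x, MDiffAt (g.pair V (FiberBundle.extend E v)) x) :
    MDiffAt (T% V) x := by
  let t := trivializationAt E (TangentSpace I : M → Type _) x
  have hx : x ∈ t.baseSet := FiberBundle.mem_baseSet_trivializationAt' x
  -- `G` is the Gram operator of the metric in the trivialization at `x`. It is invertible by
  -- nondegeneracy, so the coordinates of `V` are `G⁻¹` applied to the covector `k` of scalar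
  -- products of `V` with the coordinate fields. Both `G⁻¹` and `k` are differentiable.
  let G : M → E →L[ℝ] E →L[ℝ] ℝ := fun y ↦ ContinuousLinearMap.inCoordinates E
    (TangentSpace I : M → Type _) (E →L[ℝ] ℝ)
    (fun x : M ↦ TangentSpace I x →L[ℝ] Bundle.Trivial M ℝ x) x y x y (g.val y)
  have hG : MDiffAt G x := ((mdifferentiableAt_hom_bundle _).1
    ((g.contMDiff x).mdifferentiableAt (by simp))).2
  have hGval {y : M} (hy : y ∈ t.baseSet) (u v : E) :
      G y u v = g.val y (t.symm y u) (t.symm y v) := by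
    refine (inCoordinates_apply_eq₂ (𝕜 := ℝ) (F₁ := E) (F₂ := E) (F₃ := ℝ)
      (E₁ := (TangentSpace I : M → Type _)) (E₂ := (TangentSpace I : M → Type _))
      (E₃ := Bundle.Trivial M ℝ) hy hy (by simp)).trans ?_
    simp
    rfl
  have hsymm {y : M} (hy : y ∈ t.baseSet) (w : TangentSpace I y) : t.symm y (t ⟨y, w⟩).2 = w := by
    simpa using t.symm_apply_apply_mk hy w
  have hGinv {y : M} (hy : y ∈ t.baseSet) : (G y).IsInvertible := by
    have hinj : Function.Injective (G y).toLinearMap := by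
      rw [← LinearMap.ker_eq_bot, LinearMap.ker_eq_bot']
      intro u hu
      have h0 : t.symm y u = 0 := g.nondegenerate y _ fun w ↦ by
        rw [← hsymm hy w, ← hGval hy]
        exact congr($hu (t ⟨y, w⟩).2)
      have h1 := t.apply_mk_symm hy u
      rw [h0] at h1
      have h2 := t.zeroSection ℝ hy
      rw [zeroSection, h1] at h2
      exact congr_arg Prod.snd h2
    have hfin : finrank ℝ E = finrank ℝ (E →L[ℝ] ℝ) := by
      rw [← LinearMap.toContinuousLinearMap.finrank_eq (R := ℝ) (M := E →ₗ[ℝ] ℝ)]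
      exact Subspace.dual_finrank_eq.symm
    exact ⟨(LinearEquiv.ofInjectiveOfFinrankEq _ hinj hfin).toContinuousLinearEquiv, by ext; rfl⟩
  let b := Module.finBasis ℝ E
  let k : M → E →L[ℝ] ℝ := fun y ↦
    ∑ i, g.val y (V y) (t.symm y (b i)) • LinearMap.toContinuousLinearMap (b.coord i)
  have hk : MDiffAt k x := by
    have h1 (i) : MDiffAt (fun y ↦ g.val y (V y) (t.symm y (b i))) x := by
      have h2 : (t ⟨x, t.symm x (b i)⟩).2 = b i := by
        simp [t.apply_mk_symm hx]
      have := hV (t.symm x (b i))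
      unfold FiberBundle.extend at this
      change MDiffAt (fun y ↦ g.val y (V y) (t.symm y (t ⟨x, t.symm x (b i)⟩).2)) x at this
      rwa [h2] at this
    exact mdifferentiableAt_sum _ fun i ↦ (h1 i).smul mdifferentiableAt_const
  have hinv : MDiffAt (fun y ↦ ContinuousLinearMap.inverse (G y)) x :=
    ((hGinv hx).contDiffAt_map_inverse.differentiableAt (n := 1) one_ne_zero).comp_mdifferentiableAt
      hG
  rw [mdifferentiableAt_section]
  refine (hinv.clm_apply hk).congr_of_eventuallyEq ?_
  filter_upwards [t.open_baseSet.mem_nhds hx] with y hy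
  have hk' : k y = G y (t ⟨y, V y⟩).2 := by
    refine ContinuousLinearMap.coe_injective (b.ext fun i ↦ ?_)
    simp [k, hGval hy, hsymm hy, Finsupp.single_apply]
  rw [hk', (hGinv hy).inverse_apply_self]

/-- `leviCivita` is chosen from an existence statement, so only its two axioms are available; they
force the Koszul formula back. -/
lemma koszul_leviCivita {X Y Z : Π x : M, TangentSpace I x} {x : M}
    (hX : MDiffAt (T% X) x) (hY : MDiffAt (T% Y) x) (hZ : MDiffAt (T% Z) x) :
    g.koszul X Y Z x = 2 * g.pair (g.nabla X Y) Z x := by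
  have ht {X Y : Π x : M, TangentSpace I x} (hX : MDiffAt (T% X) x) (hY : MDiffAt (T% Y) x) :=
    (CovariantDerivative.torsion_eq_zero_iff _).1
      g.isLeviCivita_leviCivita.torsion_eq_zero hX hY
  simp only [koszul, ← ht hX hY, ← ht hX hZ, ← ht hY hZ, g.isLeviCivita_leviCivita.metric hY hZ,
    g.isLeviCivita_leviCivita.metric hX hZ, g.isLeviCivita_leviCivita.metric hX hY, pair, nabla]
  simp [g.symm x (X x), g.symm x (Y x)]
  ring

/-- Smoothness is not part of the data of the connection. It comes from the Koszul formula, whose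
right-hand side is visibly differentiable and determines every scalar product of `∇_X Y`. -/
lemma mdifferentiableAt_nabla {X Y : Π x : M, TangentSpace I x} {x : M}
    (hX : CMDiffAt 2 (T% X) x) (hY : CMDiffAt 2 (T% Y) x) : MDiffAt (T% (g.nabla X Y)) x := by
  refine g.mdifferentiableAt_of_pair fun v ↦ ?_
  have hv : CMDiffAt 2 (T% (FiberBundle.extend E v)) x := FiberBundle.contMDiffAt_extend I E v
  have h := (mdifferentiableAt_const (c := (1 / 2 : ℝ))).mul (g.mdifferentiableAt_koszul hX hY hv)
  refine h.congr_of_eventuallyEq ?_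
  filter_upwards [eventually_mdifferentiableAt hX, eventually_mdifferentiableAt hY,
    eventually_mdifferentiableAt hv] with y h1 h2 h3
  simp [g.koszul_leviCivita h1 h2 h3]

end PseudoRiemannianMetric

end Regularity

end ParaGeometry

namespace ParaGeometry

/-! ### Symmetries of the curvature -/

section Curvature

variable {E : Type*} [NormedAddCommGroup E] [NormedSpace ℝ E]
  {H : Type*} [TopologicalSpace H] {I : ModelWithCorners ℝ E H}
  {M : Type*} [TopologicalSpace M] [ChartedSpace H M] [IsManifold I ∞ M]

lemma mvfderiv_congr {f f' : M → ℝ} {x : M} (h : f =ᶠ[𝓝 x] f') :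
    mvfderiv I f x = mvfderiv I f' x := by
  ext v
  exact congr($(h.mfderiv_eq (I := I) (I' := 𝓘(ℝ, ℝ))) v)

lemma eventually_mdifferentiableAt_fun {f : M → ℝ} {x : M}
    (hf : CMDiffAt 2 f x) : ∀ᶠ y in 𝓝 x, MDiffAt f y :=
  ((contMDiffAt_iff_contMDiffAt_nhds (by simp)).1 hf).mono
    fun _ hy ↦ hy.mdifferentiableAt two_ne_zero

variable [CompleteSpace E]

lemma jacobi_mlieBracket {X Y Z : Π x : M, TangentSpace I x} {x : M}
    (hX : CMDiffAt 2 (T% X) x) (hY : CMDiffAt 2 (T% Y) x) (hZ : CMDiffAt 2 (T% Z) x) :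
    mlieBracket I X (mlieBracket I Y Z) x =
      mlieBracket I (mlieBracket I X Y) Z x + mlieBracket I Y (mlieBracket I X Z) x := by
  have : IsManifold I (minSmoothness ℝ 3) M := by
    rw [minSmoothness_of_isRCLikeNormedField]; infer_instance
  exact leibniz_identity_mlieBracket_apply (by simpa using hX) (by simpa using hY)
    (by simpa using hZ)

variable [FiniteDimensional ℝ E]

/-- The Lie bracket acts on functions as the commutator. -/
lemma mvfderiv_mlieBracket {f : M → ℝ} {X Y : Π x : M, TangentSpace I x} {x : M}
    (hf : CMDiffAt 2 f x) (hX : CMDiffAt 2 (T% X) x) (hY : CMDiffAt 2 (T% Y) x) :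
    mvfderiv I f x (mlieBracket I X Y x) =
      mvfderiv I (fun y ↦ mvfderiv I f y (Y y)) x (X x)
        - mvfderiv I (fun y ↦ mvfderiv I f y (X y)) x (Y x) := by
  -- The identity is read off from the Jacobi identity for `X`, `Y`, `f Z`, as the coefficient of `Z
  -- x`; this requires some `Z x ≠ 0`.
  rcases subsingleton_or_nontrivial (TangentSpace I x) with h0 | h0
  · simp [Subsingleton.elim (mlieBracket I X Y x) 0, Subsingleton.elim (X x) 0,
      Subsingleton.elim (Y x) 0]
  obtain ⟨w, hw⟩ := exists_ne (0 : TangentSpace I x)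
  let Z : Π x : M, TangentSpace I x := FiberBundle.extend E w
  have hZ : CMDiffAt 2 (T% Z) x := FiberBundle.contMDiffAt_extend I E w
  have hZx : Z x = w := by simp [Z]
  have d := hZ.mdifferentiableAt two_ne_zero
  have df := hf.mdifferentiableAt two_ne_zero
  -- The two middle terms are exchanged when `X` and `Y` are, so they cancel in the commutator.
  have key {X Y : Π x : M, TangentSpace I x} (hX : CMDiffAt 2 (T% X) x)
      (hY : CMDiffAt 2 (T% Y) x) : mlieBracket I X (mlieBracket I Y (f • Z)) x =
        mvfderiv I (fun y ↦ mvfderiv I f y (Y y)) x (X x) • Z x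
          + mvfderiv I f x (Y x) • mlieBracket I X Z x
          + mvfderiv I f x (X x) • mlieBracket I Y Z x
          + f x • mlieBracket I X (mlieBracket I Y Z) x := by
    have hYf := mdifferentiableAt_mvfderiv_apply hf (hY.mdifferentiableAt two_ne_zero)
    have hYZ := mdifferentiableAt_mlieBracket hY hZ
    have h1 : mlieBracket I Y (f • Z) =ᶠ[𝓝 x]
        (fun y ↦ mvfderiv I f y (Y y)) • Z + f • mlieBracket I Y Z := by
      filter_upwards [eventually_mdifferentiableAt_fun hf, eventually_mdifferentiableAt hZ]
        with y h1 h2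
      exact mlieBracket_smul_right h1 h2
    rw [Filter.EventuallyEq.mlieBracket_vectorField_eq (Filter.EventuallyEq.refl _ X) h1,
      mlieBracket_add_right (hYf.smul_section d) (df.smul_section hYZ),
      mlieBracket_smul_right hYf d, mlieBracket_smul_right df hYZ]
    module
  have h1 := key hX hY
  have h2 := key hY hX
  have h3 := jacobi_mlieBracket hX hY (Z := f • Z) (hf.smul_section hZ)
  rw [h1, h2, mlieBracket_smul_right df d, jacobi_mlieBracket hX hY hZ] at h3
  have h4 : (mvfderiv I f x (mlieBracket I X Y x) -
      (mvfderiv I (fun y ↦ mvfderiv I f y (Y y)) x (X x)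
        - mvfderiv I (fun y ↦ mvfderiv I f y (X y)) x (Y x))) • w = 0 := by
    rw [← hZx]
    linear_combination (norm := module) (-1 : ℝ) • h3
  exact sub_eq_zero.1 ((smul_eq_zero.1 h4).resolve_right hw)

namespace PseudoRiemannianMetric

variable (g : PseudoRiemannianMetric I M)

lemma torsion_nabla {X Y : Π x : M, TangentSpace I x} {x : M}
    (hX : MDiffAt (T% X) x) (hY : MDiffAt (T% Y) x) :
    g.nabla X Y x - g.nabla Y X x = mlieBracket I X Y x :=
  (CovariantDerivative.torsion_eq_zero_iff _).1 g.isLeviCivita_leviCivita.torsion_eq_zero hX hY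

lemma mvfderiv_pair {X Y Z : Π x : M, TangentSpace I x} {x : M}
    (hY : MDiffAt (T% Y) x) (hZ : MDiffAt (T% Z) x) :
    mvfderiv I (g.pair Y Z) x (X x) = g.pair (g.nabla X Y) Z x + g.pair Y (g.nabla X Z) x :=
  g.isLeviCivita_leviCivita.metric hY hZ (X x)

lemma leviCivita_congr {Y Y' : Π x : M, TangentSpace I x} {x : M} (hY : MDiffAt (T% Y) x)
    (h : ∀ᶠ y in 𝓝 x, Y y = Y' y) : g.leviCivita Y x = g.leviCivita Y' x := by
  refine g.leviCivita.isCovariantDerivativeOn.congr_of_eventuallyEq hY ?_ Filter.univ_mem h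
  refine hY.congr_of_eventuallyEq ?_
  filter_upwards [h] with y hy
  rw [hy]

lemma leviCivita_sub {Y Y' : Π x : M, TangentSpace I x} {x : M} (hY : MDiffAt (T% Y) x)
    (hY' : MDiffAt (T% Y') x) :
    g.leviCivita (Y - Y') x = g.leviCivita Y x - g.leviCivita Y' x := by
  have h := g.leviCivita.isCovariantDerivativeOn.add
    (mdifferentiableAt_sub_section hY hY') hY'
  rw [sub_add_cancel] at h
  rw [h, add_sub_cancel_right]

/-- The first Bianchi identity. -/
lemma curvature_cyclic {X Y Z : Π x : M, TangentSpace I x} {x : M}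
    (hX : CMDiffAt 2 (T% X) x) (hY : CMDiffAt 2 (T% Y) x) (hZ : CMDiffAt 2 (T% Z) x) :
    g.curvature X Y Z x + g.curvature Y Z X x + g.curvature Z X Y x = 0 := by
  -- Vanishing torsion, used for the pair `Y, Z` and then for `X, [Y, Z]`, turns the cyclic sum of
  -- curvatures into the Jacobi identity.
  have key {X Y Z : Π x : M, TangentSpace I x}
      (hX : CMDiffAt 2 (T% X) x) (hY : CMDiffAt 2 (T% Y) x) (hZ : CMDiffAt 2 (T% Z) x) :
      g.nabla X (g.nabla Y Z) x - g.nabla X (g.nabla Z Y) x - g.nabla (mlieBracket I Y Z) X x =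
        mlieBracket I X (mlieBracket I Y Z) x := by
    have h1 := g.mdifferentiableAt_nabla hY hZ
    have h2 := g.mdifferentiableAt_nabla hZ hY
    have h3 : g.leviCivita (mlieBracket I Y Z) x = g.leviCivita (g.nabla Y Z - g.nabla Z Y) x := by
      refine g.leviCivita_congr (mdifferentiableAt_mlieBracket hY hZ) ?_
      filter_upwards [eventually_mdifferentiableAt hY, eventually_mdifferentiableAt hZ]
        with y h1 h2
      exact (g.torsion_nabla h1 h2).symm
    rw [← g.torsion_nabla (hX.mdifferentiableAt two_ne_zero) (mdifferentiableAt_mlieBracket hY hZ)]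
    congr 1
    change _ = g.leviCivita _ x (X x)
    rw [h3, g.leviCivita_sub h1 h2]
    rfl
  have j := jacobi_mlieBracket hX hY hZ
  rw [mlieBracket_swap_apply (V := mlieBracket I X Y), mlieBracket_swap (V := X) (W := Z)] at j
  have h0 : mlieBracket I Y (-mlieBracket I Z X) x = -mlieBracket I Y (mlieBracket I Z X) x := by
    have := mlieBracket_const_smul_right (c := (-1 : ℝ)) (V := Y)
      (mdifferentiableAt_mlieBracket hZ hX)
    simpa using this
  rw [h0, ← key hX hY hZ, ← key hY hZ hX, ← key hZ hX hY] at j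
  simp only [curvature, Pi.sub_apply]
  linear_combination (norm := module) (1 : ℝ) • j

/-- Apply `XY - YX - [X, Y] = 0` to the function `g(Z, W)` and expand by metric compatibility; the
mixed terms `g(∇Z, ∇W)` cancel. -/
lemma pair_curvature {X Y Z W : Π x : M, TangentSpace I x} {x : M}
    (hX : CMDiffAt 2 (T% X) x) (hY : CMDiffAt 2 (T% Y) x) (hZ : CMDiffAt 2 (T% Z) x)
    (hW : CMDiffAt 2 (T% W) x) :
    g.val x (g.curvature X Y Z x) (W x) = -g.val x (Z x) (g.curvature X Y W x) := by
  have dZ := hZ.mdifferentiableAt two_ne_zero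
  have dW := hW.mdifferentiableAt two_ne_zero
  have key {X Y : Π x : M, TangentSpace I x}
      (hX : CMDiffAt 2 (T% X) x) (hY : CMDiffAt 2 (T% Y) x) :
      mvfderiv I (fun y ↦ mvfderiv I (g.pair Z W) y (Y y)) x (X x) =
        g.pair (g.nabla X (g.nabla Y Z)) W x + g.pair (g.nabla Y Z) (g.nabla X W) x
        + (g.pair (g.nabla X Z) (g.nabla Y W) x + g.pair Z (g.nabla X (g.nabla Y W)) x) := by
    have h1 : (fun y ↦ mvfderiv I (g.pair Z W) y (Y y)) =ᶠ[𝓝 x]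
        g.pair (g.nabla Y Z) W + g.pair Z (g.nabla Y W) := by
      filter_upwards [eventually_mdifferentiableAt hZ, eventually_mdifferentiableAt hW]
        with y h1 h2
      exact g.mvfderiv_pair h1 h2
    have h2 := g.mdifferentiableAt_nabla hY hZ
    have h3 := g.mdifferentiableAt_nabla hY hW
    rw [mvfderiv_congr h1, mvfderiv_add (g.mdiff_pair h2 dW) (g.mdiff_pair dZ h3),
      _root_.add_apply, g.mvfderiv_pair h2 dW, g.mvfderiv_pair dZ h3]
  have h := mvfderiv_mlieBracket (g.contMDiffAt_pair (k := 2) hZ hW) hX hY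
  rw [key hX hY, key hY hX, g.mvfderiv_pair dZ dW] at h
  simp only [pair] at h
  simp only [curvature, Pi.sub_apply, map_sub, _root_.sub_apply]
  linarith

end PseudoRiemannianMetric

end Curvature

end ParaGeometry

namespace ParaGeometry

lemma trace_eq_sum_coord {ι V : Type*} [Fintype ι] [AddCommGroup V] [Module ℝ V]
    (b : Basis ι ℝ V) (T : V →ₗ[ℝ] V) : LinearMap.trace ℝ V T = ∑ i, b.coord i (T (b i)) := by
  classical
  rw [LinearMap.trace_eq_matrix_trace ℝ b]
  simp [Matrix.trace, LinearMap.toMatrix_apply]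

/-! ### Second covariant derivatives of a field with symmetric `∇V` -/

section Hessian

variable {E : Type*} [NormedAddCommGroup E] [NormedSpace ℝ E]
  {H : Type*} [TopologicalSpace H] {I : ModelWithCorners ℝ E H}
  {M : Type*} [TopologicalSpace M] [ChartedSpace H M] [IsManifold I ∞ M]
  [CompleteSpace E] [FiniteDimensional ℝ E]

namespace PseudoRiemannianMetric

variable (g : PseudoRiemannianMetric I M)

namespace IsPseudoOrthonormal

variable {g} {ι : Type*} [Fintype ι] {x : M} {e : ι → TangentSpace I x} {ε : ι → ℝ}

lemma sign_mul_self (he : g.IsPseudoOrthonormal x e ε) (i : ι) : ε i * ε i = 1 := by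
  rcases he.sign i with h | h <;> simp [h]

lemma val_sum_smul (he : g.IsPseudoOrthonormal x e ε) (c : ι → ℝ) (i : ι) :
    g.val x (∑ j, c j • e j) (e i) = c i * ε i := by
  classical
  simp only [map_sum, map_smul, _root_.sum_apply, _root_.smul_apply, smul_eq_mul]
  rw [Finset.sum_eq_single i (fun j _ hj ↦ by rw [he.ortho j i hj, mul_zero]) (by simp), he.self]

/-- Pairing a combination with `e i` returns its coefficient times `ε i`, and `ε i * ε i = 1`; this
gives both independence and the coordinates. -/
lemma exists_basis (he : g.IsPseudoOrthonormal x e ε) (hι : Fintype.card ι = finrank ℝ E) :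
    ∃ b : Basis ι ℝ (TangentSpace I x), (∀ i, b i = e i) ∧
      ∀ i v, b.coord i v = ε i * g.val x v (e i) := by
  have : FiniteDimensional ℝ (TangentSpace I x) := inferInstanceAs (FiniteDimensional ℝ E)
  have hli : LinearIndependent ℝ e := by
    rw [Fintype.linearIndependent_iff]
    intro c hc i
    have h1 := he.val_sum_smul c i
    rw [hc] at h1
    have h2 := he.sign_mul_self i
    simp only [map_zero, _root_.zero_apply] at h1
    linear_combination (-c i) * h2 - ε i * h1
  have hcoe := coe_basisOfLinearIndependentOfCardEqFinrank' e hli hι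
  refine ⟨basisOfLinearIndependentOfCardEqFinrank' e hli hι, fun i ↦ by rw [hcoe], fun i v ↦ ?_⟩
  set b := basisOfLinearIndependentOfCardEqFinrank' e hli hι
  have h1 := he.val_sum_smul (fun j ↦ b.coord j v) i
  have h2 : ∑ j, b.coord j v • e j = v := by
    rw [← hcoe]
    exact b.sum_repr v
  rw [h2] at h1
  have h3 := he.sign_mul_self i
  rw [h1]
  linear_combination (-b.coord i v) * h3

lemma trace_eq (he : g.IsPseudoOrthonormal x e ε) (hι : Fintype.card ι = finrank ℝ E)
    (T : TangentSpace I x →ₗ[ℝ] TangentSpace I x) :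
    LinearMap.trace ℝ (TangentSpace I x) T = ∑ i, ε i * g.val x (T (e i)) (e i) := by
  obtain ⟨b, hb, hc⟩ := he.exists_basis hι
  rw [trace_eq_sum_coord b]
  simp [hc, hb]

lemma sum_smul_eq (he : g.IsPseudoOrthonormal x e ε) (hι : Fintype.card ι = finrank ℝ E)
    (v : TangentSpace I x) : ∑ i, (ε i * g.val x v (e i)) • e i = v := by
  obtain ⟨b, hb, hc⟩ := he.exists_basis hι
  conv_rhs => rw [← b.sum_repr v]
  exact Finset.sum_congr rfl fun i _ ↦ by rw [hb, ← hc, b.coord_apply]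

end IsPseudoOrthonormal

/-- The second covariant derivative `v ↦ ∇²_{v, w} V`. -/
def hess (V : Π x : M, TangentSpace I x) (x : M) (w : TangentSpace I x) :
    TangentSpace I x →L[ℝ] TangentSpace I x :=
  g.leviCivita (g.nabla (FiberBundle.extend E w) V) x
    - g.leviCivita V x ∘L g.leviCivita (FiberBundle.extend E w) x

variable {g} {V : Π x : M, TangentSpace I x}

/-- Differentiate `g(∇_Y V, Z) = g(Y, ∇_Z V)` along `X`: the covariant derivative of a symmetric
endomorphism is symmetric. -/
lemma val_nabla_nabla_symm (hV : CMDiff 2 (T% V))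
    (hA : ∀ y v w, g.val y (g.leviCivita V y v) w = g.val y v (g.leviCivita V y w))
    {X Y Z : Π x : M, TangentSpace I x} {x : M}
    (hY : CMDiffAt 2 (T% Y) x) (hZ : CMDiffAt 2 (T% Z) x) :
    g.val x (g.nabla X (g.nabla Y V) x - g.nabla (g.nabla X Y) V x) (Z x) =
      g.val x (Y x) (g.nabla X (g.nabla Z V) x - g.nabla (g.nabla X Z) V x) := by
  have h1 := g.mvfderiv_pair (X := X) (g.mdifferentiableAt_nabla hY (hV x))
    (hZ.mdifferentiableAt two_ne_zero)
  have h2 := g.mvfderiv_pair (X := X) (hY.mdifferentiableAt two_ne_zero)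
    (g.mdifferentiableAt_nabla hZ (hV x))
  have h3 : g.pair (g.nabla Y V) Z = g.pair Y (g.nabla Z V) := funext fun y ↦ hA y _ _
  rw [h3, h2] at h1
  have h4 : g.val x (g.nabla (g.nabla X Y) V x) (Z x) = g.pair (g.nabla X Y) (g.nabla Z V) x :=
    hA x _ _
  have h5 : g.pair (g.nabla Y V) (g.nabla X Z) x = g.val x (Y x) (g.nabla (g.nabla X Z) V x) :=
    hA x _ _
  simp only [map_sub, _root_.sub_apply, h4, ← h5]
  simp only [pair] at h1 ⊢
  linarith

/-- This is tensoriality in `Y`, obtained from symmetry: moved to the other side of the scalar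
product, `Y` enters only through its value at `x`. -/
lemma nabla_nabla_eq_hess (hV : CMDiff 2 (T% V))
    (hA : ∀ y v w, g.val y (g.leviCivita V y v) w = g.val y v (g.leviCivita V y w))
    {X Y : Π x : M, TangentSpace I x} {x : M} (hY : CMDiffAt 2 (T% Y) x) :
    g.nabla X (g.nabla Y V) x - g.nabla (g.nabla X Y) V x = g.hess V x (Y x) (X x) := by
  have hext (w : TangentSpace I x) : CMDiffAt 2 (T% (FiberBundle.extend E w)) x :=
    FiberBundle.contMDiffAt_extend I E w
  refine g.eq_of_val_eq fun u ↦ ?_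
  have h1 := val_nabla_nabla_symm (X := X) hV hA hY (hext u)
  have h2 := val_nabla_nabla_symm (X := X) hV hA (hext (Y x)) (hext u)
  simp only [FiberBundle.extend_apply_self] at h1 h2
  rw [h1, ← h2]
  rfl

lemma val_hess_symm (hV : CMDiff 2 (T% V))
    (hA : ∀ y v w, g.val y (g.leviCivita V y v) w = g.val y v (g.leviCivita V y w))
    {x : M} (v w u : TangentSpace I x) :
    g.val x (g.hess V x w v) u = g.val x w (g.hess V x u v) := by
  have hext (w : TangentSpace I x) : CMDiffAt 2 (T% (FiberBundle.extend E w)) x :=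
    FiberBundle.contMDiffAt_extend I E w
  have h := val_nabla_nabla_symm (X := FiberBundle.extend E v) hV hA (hext w) (hext u)
  rw [nabla_nabla_eq_hess hV hA (hext w), nabla_nabla_eq_hess hV hA (hext u)] at h
  simpa using h

/-- The second covariant derivative `w ↦ ∇²_{v, w} V`, when `∇ V` is symmetric. -/
def hessRight (hV : CMDiff 2 (T% V))
    (hA : ∀ y v w, g.val y (g.leviCivita V y v) w = g.val y v (g.leviCivita V y w))
    (x : M) (v : TangentSpace I x) : TangentSpace I x →ₗ[ℝ] TangentSpace I x where
  toFun w := g.hess V x w v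
  -- `w` enters `hess` through a chosen extension, so linearity is not visible there;
  -- `val_hess_symm` makes `w` a plain argument of the metric.
  map_add' w w' := g.eq_of_val_eq fun u ↦ by
    simp only [map_add, _root_.add_apply, val_hess_symm hV hA]
  map_smul' c w := g.eq_of_val_eq fun u ↦ by
    simp only [map_smul, _root_.smul_apply, val_hess_symm hV hA, RingHom.id_apply]

lemma leviCivita_sum_smul {ι : Type*} (s : Finset ι) {f : ι → M → ℝ}
    {X : ι → Π x : M, TangentSpace I x} {x : M} (hf : ∀ i, MDiffAt (f i) x)
    (hX : ∀ i, MDiffAt (T% (X i)) x) (v : TangentSpace I x) :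
    g.leviCivita (fun y ↦ ∑ i ∈ s, f i y • X i y) x v =
      ∑ i ∈ s, (f i x • g.leviCivita (X i) x v + mvfderiv I (f i) x v • X i x) := by
  classical
  have hcov := g.leviCivita.isCovariantDerivativeOn (s := Set.univ)
  induction s using Finset.induction_on with
  | empty =>
    have := hcov.zero (x := x)
    simp only [Finset.sum_empty]
    exact congr($this v)
  | insert a s ha h =>
    simp only [Finset.sum_insert ha, ← h]
    have h1 := hcov.add ((hf a).smul_section (hX a))
      (MDifferentiableAt.sum_section (s := s) fun i _ ↦ (hf i).smul_section (hX i))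
    have h2 := hcov.leibniz (hX a) (hf a)
    rw [h2] at h1
    exact congr($h1 v)

/-- The trace commutes with covariant differentiation. -/
lemma trace_hessRight (hV : CMDiff 2 (T% V))
    (hA : ∀ y v w, g.val y (g.leviCivita V y v) w = g.val y v (g.leviCivita V y w))
    (x : M) (v : TangentSpace I x) :
    LinearMap.trace ℝ (TangentSpace I x) (hessRight hV hA x v) =
      mvfderiv I (fun y ↦ LinearMap.trace ℝ (TangentSpace I y) (g.leviCivita V y).toLinearMap)
        x v := by
  let t := trivializationAt E (TangentSpace I : M → Type _) x
  have hx : x ∈ t.baseSet := FiberBundle.mem_baseSet_trivializationAt' x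
  let b := Module.finBasis ℝ E
  let s := t.localFrame b
  let c := t.localFrameCoeff I b
  let A (y : M) := (g.leviCivita V y).toLinearMap
  let X : Π x : M, TangentSpace I x := FiberBundle.extend E v
  have hs (i) : CMDiffAt 2 (T% (s i)) x := contMDiffAt_localFrame_of_mem 2 _ b i hx
  have hs' (i) := (hs i).mdifferentiableAt two_ne_zero
  have hAs (i) : MDiffAt (T% (g.nabla (s i) V)) x := g.mdifferentiableAt_nabla (hs i) (hV x)
  let a (i j) (y : M) : ℝ := c j y (A y (s i y))
  have ha (i j) : MDiffAt (a i j) x := mdifferentiableAt_localFrameCoeff b hx (hAs i) j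
  have hsb {y : M} (hy : y ∈ t.baseSet) (i) : s i y = t.basisAt b hy i := by simp [s, hy]
  have hcb {y : M} (hy : y ∈ t.baseSet) (i) (w : TangentSpace I y) :
      c i y w = (t.basisAt b hy).coord i w := by
    have := t.localFrameCoeff_apply_of_mem_baseSet (I := I) (b := b) hy (FiberBundle.extend E w) i
    simpa using this
  have htr : (fun y ↦ LinearMap.trace ℝ (TangentSpace I y) (A y)) =ᶠ[𝓝 x]
      fun y ↦ ∑ i, a i i y := by
    filter_upwards [t.open_baseSet.mem_nhds hx] with y hy
    rw [trace_eq_sum_coord (t.basisAt b hy)]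
    simp only [a, hcb hy, hsb hy]
  rw [mvfderiv_congr htr, mvfderiv_sum _ fun i ↦ ha i i]
  let B := t.basisAt b hx
  -- `C` is the connection form of the local frame in the direction `v`. In the frame, `∇_v A` is
  -- the derivative of the matrix of `A` plus the commutator of `C` and `A`, and the commutator has
  -- trace zero.
  let C : TangentSpace I x →ₗ[ℝ] TangentSpace I x :=
    B.constr ℝ fun j ↦ g.leviCivita (s j) x v
  have hC (j) : C (B j) = g.leviCivita (s j) x v := B.constr_basis ..
  have key (i) : hessRight hV hA x v (B i) =
      ∑ j, mvfderiv I (a i j) x v • B j + C (A x (B i)) - A x (C (B i)) := by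
    have h1 := nabla_nabla_eq_hess (X := X) hV hA (hs i)
    have h2 : g.nabla X (g.nabla (s i) V) x = g.leviCivita (g.nabla (s i) V) x v := by
      simp [nabla, X]
    have h3 : g.leviCivita (g.nabla (s i) V) x =
        g.leviCivita (fun y ↦ ∑ j, a i j y • s j y) x := by
      refine g.leviCivita_congr (hAs i) ?_
      filter_upwards [t.open_baseSet.mem_nhds hx] with y hy
      simp only [a, hcb hy, hsb hy]
      change A y (s i y) = _
      rw [hsb hy]
      exact ((t.basisAt b hy).sum_repr _).symm
    have h4 : C (A x (B i)) = ∑ j, a i j x • g.leviCivita (s j) x v := by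
      conv_lhs => rw [← B.sum_repr (A x (B i))]
      simp only [map_sum, map_smul, hC, a, hcb hx, hsb hx]
      rfl
    rw [h2, h3, leviCivita_sum_smul _ (ha i) hs' v, Finset.sum_add_distrib] at h1
    have h5 : hessRight hV hA x v (B i) = g.hess V x (s i x) (X x) := by
      simp [hessRight, X, hsb hx, B]
    have h6 : g.nabla (g.nabla X (s i)) V x = A x (C (B i)) := by
      simp [hC, nabla, X, A]
    rw [h5, ← h1, h6, h4]
    simp only [hsb hx, B]
    abel
  rw [trace_eq_sum_coord B]
  simp only [key, map_add, map_sub, Finset.sum_add_distrib, Finset.sum_sub_distrib]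
  have h1 := trace_eq_sum_coord B (C * A x)
  have h2 := trace_eq_sum_coord B (A x * C)
  rw [LinearMap.trace_mul_comm] at h1
  simp only [Module.End.mul_apply] at h1 h2
  rw [← h1, ← h2]
  simp [Finsupp.single_apply]

/-- Symmetry moves the frame vector out of `hess` and puts `u` in, leaving a trace that no longer
involves the frame. Hence the rough Laplacian is independent of the frame. -/
lemma val_roughLaplacianAlong (hV : CMDiff 2 (T% V))
    (hA : ∀ y v w, g.val y (g.leviCivita V y v) w = g.val y v (g.leviCivita V y w))
    {ι : Type*} [Fintype ι] (hι : Fintype.card ι = finrank ℝ E) {x : M}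
    {e : ι → Π x : M, TangentSpace I x} {ε : ι → ℝ} (he : ∀ i, CMDiffAt 2 (T% (e i)) x)
    (hon : g.IsPseudoOrthonormal x (fun i ↦ e i x) ε) (u : TangentSpace I x) :
    g.val x (g.roughLaplacianAlong e ε V x) u =
      -LinearMap.trace ℝ (TangentSpace I x) (g.hess V x u).toLinearMap := by
  rw [hon.trace_eq hι, roughLaplacianAlong]
  simp only [nabla_nabla_eq_hess hV hA (he _), map_neg, _root_.neg_apply, map_sum, map_smul,
    _root_.sum_apply, _root_.smul_apply, val_hess_symm hV hA, smul_eq_mul]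
  simp [g.symm x (e _ x)]

lemma ricci_eq_trace_hess (hV : CMDiff 2 (T% V))
    (hA : ∀ y v w, g.val y (g.leviCivita V y v) w = g.val y v (g.leviCivita V y w))
    {x : M} (w : TangentSpace I x) :
    g.ricci x (V x) w = LinearMap.trace ℝ (TangentSpace I x) (g.hess V x w).toLinearMap
      - LinearMap.trace ℝ (TangentSpace I x) (hessRight hV hA x w) := by
  have hon := g.isPseudoOrthonormal_basisAt x
  rw [hon.trace_eq (by simp), hon.trace_eq (by simp), ← Finset.sum_sub_distrib, ricci]
  refine Finset.sum_congr rfl fun i _ ↦ ?_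
  rw [← mul_sub]
  congr 1
  set v := g.basisAt x i
  let X : Π x : M, TangentSpace I x := FiberBundle.extend E v
  let Y : Π x : M, TangentSpace I x := FiberBundle.extend E (V x)
  let Z : Π x : M, TangentSpace I x := FiberBundle.extend E w
  have hX : CMDiffAt 2 (T% X) x := FiberBundle.contMDiffAt_extend I E v
  have hY : CMDiffAt 2 (T% Y) x := FiberBundle.contMDiffAt_extend I E (V x)
  have hZ : CMDiffAt 2 (T% Z) x := FiberBundle.contMDiffAt_extend I E w
  have eX : X x = v := by simp [X]
  have eY : Y x = V x := by simp [Y]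
  have eZ : Z x = w := by simp [Z]
  have h1 := congr(g.val x $(g.curvature_cyclic hX hY hZ) v)
  -- Skew-symmetry kills the middle Bianchi term, so `g(R(X, Y)Z, X) = -g(R(Z, X)Y, X)`. Both `h3`
  -- and `h4` reduce to `R(Z, X)X`, which lets `V` itself replace the extension `Y` of its value at
  -- `x`.
  have h2 := g.pair_curvature hY hZ hX hX
  have h3 := g.pair_curvature hZ hX hY hX
  have h4 := g.pair_curvature hZ hX (hV x) hX
  have h5 : g.curvature Z X V x = g.hess V x v w - g.hess V x w v := by
    have h6 := nabla_nabla_eq_hess (X := Z) hV hA hX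
    have h7 := nabla_nabla_eq_hess (X := X) hV hA hZ
    have h8 : g.nabla (mlieBracket I Z X) V x =
        g.nabla (g.nabla Z X) V x - g.nabla (g.nabla X Z) V x := by
      simp only [nabla]
      rw [← g.torsion_nabla (hZ.mdifferentiableAt two_ne_zero)
        (hX.mdifferentiableAt two_ne_zero), map_sub]
      rfl
    rw [eX, eZ] at h6 h7
    simp only [curvature, Pi.sub_apply]
    rw [h8, ← h6, ← h7]
    abel
  rw [h5, eX] at h4
  rw [eX, g.symm x v] at h2
  rw [eX, eY] at h3
  simp only [map_add, map_sub, map_zero, _root_.add_apply, _root_.sub_apply,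
    _root_.zero_apply] at h1 h4
  change g.val x (g.curvature X Y Z x) v = g.val x (g.hess V x w v) v - g.val x (g.hess V x v w) v
  linarith

/-- If `∇ V` is symmetric with constant trace, then `∇*∇V = -QV`. -/
theorem roughLaplacian_eq_neg_ricciOperator (hV : CMDiff 2 (T% V))
    (hA : ∀ y v w, g.val y (g.leviCivita V y v) w = g.val y v (g.leviCivita V y w)) {c : ℝ}
    (hc : ∀ y, LinearMap.trace ℝ (TangentSpace I y) (g.leviCivita V y).toLinearMap = c) (x : M) :
    g.roughLaplacian V x = -g.ricciOperator x (V x) := by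
  have hon := g.isPseudoOrthonormal_basisAt x
  rw [← hon.sum_smul_eq (by simp) (g.roughLaplacian V x), ricciOperator, ← Finset.sum_neg_distrib]
  refine Finset.sum_congr rfl fun i _ ↦ ?_
  rw [ricci_eq_trace_hess hV hA, trace_hessRight, roughLaplacian,
    val_roughLaplacianAlong hV hA (by simp)
      (fun i ↦ FiberBundle.contMDiffAt_extend I E (g.basisAt x i)) (by simpa using hon),
    funext hc]
  simp [mvfderiv, mfderiv_const]

theorem roughLaplacianAlong_eq_roughLaplacian (hV : CMDiff 2 (T% V))
    (hA : ∀ y v w, g.val y (g.leviCivita V y v) w = g.val y v (g.leviCivita V y w))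
    {ι : Type*} [Fintype ι] (hι : Fintype.card ι = finrank ℝ E) {x : M}
    {e : ι → Π x : M, TangentSpace I x} {ε : ι → ℝ}
    (he : g.IsLocalPseudoOrthonormalFrame x e ε) :
    g.roughLaplacianAlong e ε V x = g.roughLaplacian V x := by
  refine g.eq_of_val_eq fun u ↦ ?_
  rw [val_roughLaplacianAlong hV hA hι
    (fun i ↦ (he.contMDiffAt i).of_le ENat.LEInfty.out) he.isPseudoOrthonormal.self_of_nhds,
    roughLaplacian, val_roughLaplacianAlong hV hA (by simp)
      (fun i ↦ FiberBundle.contMDiffAt_extend I E (g.basisAt x i))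
      (by simpa using g.isPseudoOrthonormal_basisAt x)]

end PseudoRiemannianMetric

end Hessian

end ParaGeometry

namespace ParaGeometry

/-! ### Almost paracontact metric and almost para-Kenmotsu structures -/

section Paracontact

variable {E : Type*} [NormedAddCommGroup E] [NormedSpace ℝ E]
  {H : Type*} [TopologicalSpace H] {I : ModelWithCorners ℝ E H}
  {M : Type*} [TopologicalSpace M] [ChartedSpace H M] [IsManifold I ∞ M]

namespace AlmostParacontactMetric

variable {n : ℕ} (S : AlmostParacontactMetric I M n)

/-- Since `φ²ξ = 0`, the formula for `φ²` at `φξ` gives `φξ = cξ`; then `c²ξ = φ²ξ = 0`. -/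
lemma φ_ξ (x : M) : S.φ x (S.ξ x) = 0 := by
  have h1 := S.φ_sq x (S.ξ x)
  have h2 := S.φ_sq x (S.φ x (S.ξ x))
  rw [S.η_ξ, one_smul, sub_self] at h1
  rw [h1, map_zero] at h2
  have h3 : S.φ x (S.ξ x) = S.η x (S.φ x (S.ξ x)) • S.ξ x := (sub_eq_zero.1 h2.symm)
  set c := S.η x (S.φ x (S.ξ x))
  rw [h3, map_smul, h3, smul_smul] at h1
  have h4 : c * c = 0 := by simpa [S.η_ξ] using congr(S.η x $h1)
  rw [h3, mul_self_eq_zero.1 h4, zero_smul]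

/-- Compare `φ²(φv)` with `φ(φ²v)`. -/
lemma η_φ (x : M) (v : TangentSpace I x) : S.η x (S.φ x v) = 0 := by
  have h1 := S.φ_sq x (S.φ x v)
  rw [S.φ_sq x v, map_sub, map_smul, S.φ_ξ, smul_zero, sub_zero] at h1
  simpa [S.η_ξ] using congr(S.η x $h1)

lemma val_ξ (x : M) (v : TangentSpace I x) : S.g.val x (S.ξ x) v = S.η x v := by
  have h := S.compat x (S.ξ x) v
  rw [S.φ_ξ, S.η_ξ] at h
  simp only [map_zero, _root_.zero_apply] at h
  linarith

lemma val_φ (x : M) (v w : TangentSpace I x) :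
    S.g.val x (S.φ x v) w = -S.g.val x v (S.φ x w) := by
  have h := S.compat x v (S.φ x w)
  rw [S.φ_sq, S.η_φ, map_sub, map_smul, S.g.symm x _ (S.ξ x), S.val_ξ, S.η_φ] at h
  simpa using h

lemma mdiff_ξ (x : M) : MDiffAt (T% S.ξ) x := (S.contMDiff_ξ x).mdifferentiableAt (by simp)

variable [CompleteSpace E] [FiniteDimensional ℝ E]

/-- The endomorphism `v ↦ ∇_v ξ`. -/
def shape (x : M) : TangentSpace I x →L[ℝ] TangentSpace I x := S.g.leviCivita S.ξ x

/-- Differentiate `g(ξ, ξ) = 1`. -/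
lemma η_shape (x : M) (v : TangentSpace I x) : S.η x (S.shape x v) = 0 := by
  have h := S.g.isLeviCivita_leviCivita.metric (S.mdiff_ξ x) (S.mdiff_ξ x) v
  have h1 : S.g.pair S.ξ S.ξ = fun _ ↦ 1 := by
    ext y
    simp [PseudoRiemannianMetric.pair, S.val_ξ, S.η_ξ]
  rw [h1, S.g.symm x _ (S.ξ x), S.val_ξ] at h
  have h2 : mvfderiv I (fun _ : M ↦ (1 : ℝ)) x = 0 := by simp [mvfderiv, mfderiv_const]
  rw [h2] at h
  simp only [_root_.zero_apply] at h
  change S.η x (S.g.leviCivita S.ξ x v) = 0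
  linarith

variable {S} {α : ℝ}

/-- As `η = g(ξ, ·)`, vanishing torsion gives `dη(Y, Z) = g(∇_Y ξ, Z) - g(∇_Z ξ, Y)`. -/
lemma IsAlmostParaKenmotsu.val_shape (hS : S.IsAlmostParaKenmotsu α) (x : M) (v w : TangentSpace I x) :
    S.g.val x (S.shape x v) w = S.g.val x v (S.shape x w) := by
  let Y : Π x : M, TangentSpace I x := FiberBundle.extend E v
  let Z : Π x : M, TangentSpace I x := FiberBundle.extend E w
  have hY : MDiffAt (T% Y) x := FiberBundle.mdifferentiableAt_extend I E v
  have hZ : MDiffAt (T% Z) x := FiberBundle.mdifferentiableAt_extend I E w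
  have eY : Y x = v := by simp [Y]
  have eZ : Z x = w := by simp [Z]
  have h := hS.closed x Y Z hY hZ
  have hη (X : Π x : M, TangentSpace I x) : (fun y ↦ S.η y (X y)) = S.g.pair S.ξ X :=
    funext fun y ↦ (S.val_ξ y _).symm
  simp only [extDerivOne, hη, S.g.mvfderiv_pair (S.mdiff_ξ x) hY,
    S.g.mvfderiv_pair (S.mdiff_ξ x) hZ, ← S.g.torsion_nabla hY hZ] at h
  simp only [PseudoRiemannianMetric.pair, S.val_ξ, map_sub, eY, eZ] at h
  have e1 : S.g.nabla Y S.ξ x = S.shape x v := by simp [PseudoRiemannianMetric.nabla, shape, Y]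
  have e2 : S.g.nabla Z S.ξ x = S.shape x w := by simp [PseudoRiemannianMetric.nabla, shape, Z]
  rw [e1, e2] at h
  rw [S.g.symm x v]
  linarith

lemma IsAlmostParaKenmotsu.shape_ξ (hS : S.IsAlmostParaKenmotsu α) (x : M) : S.shape x (S.ξ x) = 0 :=
  S.g.nondegenerate x _ fun w ↦ by rw [hS.val_shape, S.val_ξ, S.η_shape]

lemma h_apply (x : M) (v : TangentSpace I x) :
    S.h x v = (1 / 2 : ℝ) • S.lieDerivφ (FiberBundle.extend E v) x := rfl

/-- Since `Φ(ξ, ·) = 0`, putting `ξ` in the first slot of `dΦ = 2α η ∧ Φ` says `L_ξ Φ = 2αΦ`. On the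
other hand `L_ξ Φ = (L_ξ g)(φ·, ·) + g((L_ξ φ)·, ·)`, where `L_ξ g = 2g(A·, ·)` by symmetry of `A`
and `L_ξ φ = 2h`. -/
lemma IsAlmostParaKenmotsu.h_eq (hS : S.IsAlmostParaKenmotsu α) (x : M) (v : TangentSpace I x) :
    S.h x v = α • S.φ x v - S.shape x (S.φ x v) := by
  refine S.g.eq_of_val_eq fun w ↦ ?_
  let Y : Π x : M, TangentSpace I x := FiberBundle.extend E v
  let Z : Π x : M, TangentSpace I x := FiberBundle.extend E w
  have hY : MDiffAt (T% Y) x := FiberBundle.mdifferentiableAt_extend I E v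
  have hZ : MDiffAt (T% Z) x := FiberBundle.mdifferentiableAt_extend I E w
  have hφ := S.mdiff_φField hY
  have eY : Y x = v := by simp [Y]
  have eZ : Z x = w := by simp [Z]
  have eφ : S.φField Y x = S.φ x v := by simp [φField, Y]
  have h := hS.dΦ x S.ξ Y Z (S.mdiff_ξ x) hY hZ
  have h1 : (fun y ↦ S.fundamentalForm y (Y y) (Z y)) = S.g.pair (S.φField Y) Z := rfl
  have h2 : (fun y ↦ S.fundamentalForm y (Z y) (S.ξ y)) = 0 := by
    ext y
    simp [fundamentalForm, S.val_φ, S.φ_ξ]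
  have h3 : (fun y ↦ S.fundamentalForm y (S.ξ y) (Y y)) = 0 := by
    ext y
    simp [fundamentalForm, S.φ_ξ]
  have h4 : mlieBracket I Z S.ξ x = -mlieBracket I S.ξ Z x := mlieBracket_swap_apply
  simp only [extDerivTwo, h1, h2, h3, h4, mvfderiv_zero, _root_.zero_apply,
    S.g.mvfderiv_pair hφ hZ, ← S.g.torsion_nabla (S.mdiff_ξ x) hY,
    ← S.g.torsion_nabla (S.mdiff_ξ x) hZ, wedge, S.η_ξ, eY, eZ] at h
  have h5 := S.g.torsion_nabla (S.mdiff_ξ x) hφ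
  have e1 : S.g.nabla Y S.ξ x = S.shape x v := by simp [PseudoRiemannianMetric.nabla, shape, Y]
  have e2 : S.g.nabla Z S.ξ x = S.shape x w := by simp [PseudoRiemannianMetric.nabla, shape, Z]
  have e3 : S.g.nabla (S.φField Y) S.ξ x = S.shape x (S.φ x v) := by
    simp [PseudoRiemannianMetric.nabla, shape, Y, φField]
  rw [h_apply]
  change S.g.val x ((1 / 2 : ℝ) • S.lieDerivφ Y x) w = _
  rw [lieDerivφ, ← h5, ← S.g.torsion_nabla (S.mdiff_ξ x) hY]
  rw [e1, e2] at h
  rw [e1, e3]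
  have h6 := hS.val_shape x w (S.φ x v)
  have h7 := S.g.symm x (S.g.nabla S.ξ Z x) (S.φ x v)
  have h8 := S.g.symm x w (S.shape x (S.φ x v))
  simp only [fundamentalForm, S.φ_ξ, PseudoRiemannianMetric.pair, S.val_φ x _ (S.ξ x),
    map_sub, map_neg, map_smul, _root_.sub_apply, _root_.smul_apply,
    _root_.neg_apply, map_zero, _root_.zero_apply, smul_eq_mul, eφ, eZ] at h ⊢
  have h9 := S.val_φ x (S.shape x w) v
  have h10 := S.val_φ x (S.g.nabla S.ξ Z x) v
  linarith

/-- Apply `L_ξ` to `φ² = Id - η ⊗ ξ`. The right side is killed, because `dη = 0` and `η(ξ) = 1` give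
`L_ξ η = 0`. -/
lemma IsAlmostParaKenmotsu.h_φ (hS : S.IsAlmostParaKenmotsu α) (x : M) (v : TangentSpace I x) :
    S.h x (S.φ x v) = -S.φ x (S.h x v) := by
  let Y : Π x : M, TangentSpace I x := FiberBundle.extend E v
  have hY : MDiffAt (T% Y) x := FiberBundle.mdifferentiableAt_extend I E v
  have hφ := S.mdiff_φField hY
  have eφ : S.φField Y x = S.φ x v := by simp [φField, Y]
  let f : M → ℝ := fun y ↦ S.η y (Y y)
  have hηY : f = S.g.pair S.ξ Y := funext fun y ↦ (S.val_ξ y _).symm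
  have hf : MDiffAt f x := by
    rw [hηY]
    exact S.g.mdiff_pair (S.mdiff_ξ x) hY
  have h1 : S.h x (S.φ x v) = (1 / 2 : ℝ) • S.lieDerivφ (S.φField Y) x := by
    rw [← eφ]
    simp only [h, _root_.smul_apply]
    rw [TensorialAt.mkHom_apply _ hφ]
  have h2 : S.φField (S.φField Y) + f • S.ξ = Y := by
    ext y
    simp [φField, S.φ_sq, f]
  have h3 := mlieBracket_add_right (V := S.ξ) (S.mdiff_φField hφ) (hf.smul_section (S.mdiff_ξ x))
  rw [h2, mlieBracket_smul_right hf (S.mdiff_ξ x), mlieBracket_self] at h3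
  have h4 := hS.closed x S.ξ Y (S.mdiff_ξ x) hY
  have h5 : mvfderiv I (fun y ↦ S.η y (S.ξ y)) x = 0 := by
    rw [funext fun y ↦ S.η_ξ y]
    simp [mvfderiv, mfderiv_const]
  simp only [extDerivOne, h5, _root_.zero_apply, sub_zero] at h4
  rw [h1, h_apply]
  change _ = -S.φ x ((1 / 2 : ℝ) • S.lieDerivφ Y x)
  have h6 : mvfderiv I f x (S.ξ x) = S.η x (mlieBracket I S.ξ Y x) := sub_eq_zero.1 h4
  simp only [lieDerivφ, map_smul, map_sub, S.φ_sq]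
  rw [h6] at h3
  simp only [Pi.zero_apply, smul_zero, add_zero] at h3
  linear_combination (norm := module) (-1 / 2 : ℝ) • h3

/-- The trace identities of an almost para-Kenmotsu structure. -/
lemma IsAlmostParaKenmotsu.trace_shape (hS : S.IsAlmostParaKenmotsu α) (hE : finrank ℝ E = 2 * n + 1) (x : M) :
    LinearMap.trace ℝ (TangentSpace I x) (S.shape x).toLinearMap = 2 * n * α ∧
    LinearMap.trace ℝ (TangentSpace I x) ((S.shape x).toLinearMap * (S.shape x).toLinearMap) =
      2 * n * α ^ 2 - S.traceHSq x := by
  have : FiniteDimensional ℝ (TangentSpace I x) := inferInstanceAs (FiniteDimensional ℝ E)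
  let A : Module.End ℝ (TangentSpace I x) := (S.shape x).toLinearMap
  let φ : Module.End ℝ (TangentSpace I x) := (S.φ x).toLinearMap
  let h : Module.End ℝ (TangentSpace I x) := (S.h x).toLinearMap
  let tr := LinearMap.trace ℝ (TangentSpace I x)
  let P : Module.End ℝ (TangentSpace I x) := (S.η x).toLinearMap.smulRight (S.ξ x)
  have hφ2 : φ * φ = 1 - P := LinearMap.ext fun v ↦ S.φ_sq x v
  have hAP : A * P = 0 := LinearMap.ext fun v ↦ by
    change S.shape x (S.η x v • S.ξ x) = 0
    rw [map_smul, hS.shape_ξ, smul_zero]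
  have hh : h = α • φ - A * φ := LinearMap.ext fun v ↦ hS.h_eq x v
  have hanti : h * φ = -(φ * h) := LinearMap.ext fun v ↦ hS.h_φ x v
  have hAφ2 : A * (φ * φ) = A := by rw [hφ2, mul_sub, hAP, mul_one, sub_zero]
  have htr1 : tr (φ * φ) = 2 * n := by
    rw [hφ2, map_sub]
    have h1 : tr P = 1 := by
      simp [tr, P, S.η_ξ]
    have h2 : tr 1 = 2 * n + 1 := by
      rw [LinearMap.trace_one]
      exact_mod_cast hE
    rw [h1, h2]
    ring
  have htrA : tr A = 2 * n * α := by
    -- Anticommutation with cyclicity of the trace forces `tr(hφ) = 0`, while `hφ = αφ² - A`.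
    have h1 : tr (h * φ) = -tr (h * φ) := by
      conv_lhs => rw [hanti, map_neg, LinearMap.trace_mul_comm]
    have h2 : h * φ = α • (φ * φ) - A := by
      rw [hh, sub_mul, smul_mul_assoc, mul_assoc, hAφ2]
    rw [h2, map_sub, map_smul, htr1, smul_eq_mul] at h1
    linarith
  refine ⟨htrA, ?_⟩
  have hhh : h * h = -(α ^ 2 • (φ * φ)) + (2 * α) • A - A * A := by
    have h1 : φ * h = A - α • (φ * φ) := by
      rw [← neg_inj, ← hanti, hh, sub_mul, smul_mul_assoc, mul_assoc, hAφ2]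
      abel
    have h2 : h * h = α • (φ * h) - A * (φ * h) := by
      nth_rw 1 [hh]
      rw [sub_mul, smul_mul_assoc, mul_assoc]
    rw [h2, h1, mul_sub, mul_smul_comm, hAφ2]
    module
  have h3 : S.traceHSq x = tr (h * h) := rfl
  change tr (A * A) = _
  rw [h3, hhh, map_sub, map_add, map_neg, map_smul, map_smul, htr1, htrA]
  simp only [smul_eq_mul]
  ring

/-- By `Qξ = -∇*∇ξ`, the left side is `-tr(v ↦ ∇²_{v,ξ}ξ)`, and `∇²_{v,ξ}ξ = ∇_v(Aξ) - A(Av) =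
-A²v`. -/
lemma IsAlmostParaKenmotsu.η_ricciOperator (hS : S.IsAlmostParaKenmotsu α)
    (hE : finrank ℝ E = 2 * n + 1) (x : M) :
    -S.η x (S.g.ricciOperator x (S.ξ x)) = 2 * n * α ^ 2 - S.traceHSq x := by
  have hξ : CMDiff 2 (T% S.ξ) := S.contMDiff_ξ.of_le ENat.LEInfty.out
  have hA := hS.val_shape
  have htr (y : M) := (hS.trace_shape hE y).1
  have key := PseudoRiemannianMetric.roughLaplacian_eq_neg_ricciOperator hξ hA htr x
  rw [← neg_eq_iff_eq_neg] at key
  rw [← key, ← (hS.trace_shape hE x).2, ← S.val_ξ, S.g.symm, map_neg, _root_.neg_apply, neg_neg,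
    PseudoRiemannianMetric.roughLaplacian,
    PseudoRiemannianMetric.val_roughLaplacianAlong hξ hA (by simp)
      (fun i ↦ FiberBundle.contMDiffAt_extend I E (S.g.basisAt x i))
      (by simpa using S.g.isPseudoOrthonormal_basisAt x), ← map_neg]
  congr 1
  ext v
  let X : Π x : M, TangentSpace I x := FiberBundle.extend E v
  have h1 := PseudoRiemannianMetric.nabla_nabla_eq_hess (X := X) hξ hA (hξ x)
  have h2 : S.g.nabla S.ξ S.ξ = 0 := funext fun y ↦ hS.shape_ξ y
  have h3 : S.g.nabla X 0 x = 0 := by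
    have := (S.g.leviCivita.isCovariantDerivativeOn (s := Set.univ)).zero (x := x)
    exact congr($this (X x))
  have h4 : S.g.nabla (S.g.nabla X S.ξ) S.ξ x = S.shape x (S.shape x v) := by
    simp [PseudoRiemannianMetric.nabla, shape, X]
  rw [h2, h3, h4, zero_sub] at h1
  have h5 : X x = v := by simp [X]
  rw [h5] at h1
  change -S.g.hess S.ξ x (S.ξ x) v = S.shape x (S.shape x v)
  rw [← h1, neg_neg]

end AlmostParacontactMetric

end Paracontact

end ParaGeometry

end

theorem mainTheorem5 (n : ℕ) {M : Type*} [TopologicalSpace M]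
    [ChartedSpace (EuclideanSpace ℝ (Fin (2 * n + 1))) M] [IsManifold (𝓡 (2 * n + 1)) ∞ M]
    (S : ParaGeometry.AlmostParacontactMetric (𝓡 (2 * n + 1)) M n)
    (α : ℝ) (hS : S.IsAlmostParaKenmotsu α) :
    (∀ x : M, S.g.roughLaplacian S.ξ x =
      (2 * n * α ^ 2 - S.traceHSq x) • S.ξ x - S.horizontal x (S.g.ricciOperator x (S.ξ x))) ∧
    (∀ (x : M) (e : Fin (2 * n + 1) → Π x : M, TangentSpace (𝓡 (2 * n + 1)) x)
      (ε : Fin (2 * n + 1) → ℝ), S.g.IsLocalPseudoOrthonormalFrame x e ε →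
        S.g.roughLaplacianAlong e ε S.ξ x = S.g.roughLaplacian S.ξ x) ∧
    (S.g.IsHarmonicVectorField S.ξ ↔ S.g.IsRicciEigenvector S.ξ) := by
  have hE : finrank ℝ (EuclideanSpace ℝ (Fin (2 * n + 1))) = 2 * n + 1 := by simp
  have hξ : ContMDiff (𝓡 (2 * n + 1)) (𝓡 (2 * n + 1)).tangent 2 (T% S.ξ) :=
    S.contMDiff_ξ.of_le ENat.LEInfty.out
  have hA := hS.val_shape
  have htr (y : M) := (hS.trace_shape hE y).1
  have key := ParaGeometry.PseudoRiemannianMetric.roughLaplacian_eq_neg_ricciOperator hξ hA htr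
  refine ⟨fun x ↦ ?_, fun x e ε he ↦ ?_, ?_⟩
  -- The formula is the splitting of `-Qξ` along `ℝξ ⊕ ker η`.
  · rw [key x, ← hS.η_ricciOperator hE x, ParaGeometry.AlmostParacontactMetric.horizontal]
    module
  · exact ParaGeometry.PseudoRiemannianMetric.roughLaplacianAlong_eq_roughLaplacian hξ hA
      (by simp) he
  · simp only [ParaGeometry.PseudoRiemannianMetric.IsHarmonicVectorField,
      ParaGeometry.PseudoRiemannianMetric.IsRicciEigenvector, key]
    constructor
    · rintro ⟨f, hf⟩
      exact ⟨-f, fun x ↦ by rw [← neg_neg (S.g.ricciOperator x _), hf x]; simp⟩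
    · rintro ⟨f, hf⟩
      exact ⟨-f, fun x ↦ by rw [hf x]; simp⟩
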